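/- Let $d\ge 1$. Consider $\mathbb{Z}^d$ and the $d$-dimensional tori $\prod_i \mathbb{Z}/m_i$ with their Cayley graph structure, edges oriented and labelled by the standard generators. An LCL $\Pi=(\Sigma_{in},\Sigma_{out},t,\mathcal{P})$ on $\mathbb{Z}^d$ consists of finite sets $\Sigma_{in}\neq\emptyset$, $\Sigma_{out}$ of input and output labels ($|\Sigma_{in}|=1$ means that there are no inputs), a radius $t\in\mathbb{N}$, and a set $\mathcal{P}$ of rooted grids of radius $t$ with vertices labelled by $\Sigma_{in}\times\Sigma_{out}$. A labelling by $\Sigma_{in}\times\Sigma_{out}$ is a $\Pi$-coloring if the $t$-hop neighbourhood of every vertex is in $\mathcal{P}$. Fix constants $K\ge 1$ and an integer $a\ge 1$. We say $\Pi\in\mathsf{LOCAL}(O(\log^* n))$ if there are $f:\mathbb{N}\to\mathbb{N}$ with $f(n)=O(\log^* n)$ and a function $\mathcal{A}$ that takes $n$ and a rooted grid of radius $f(n)$ labelled with identifiers and input labels to an output label, such that for all sufficiently large $n$, on every torus with $n$ vertices and side lengths in $[n^{1/d}/K,\,K n^{1/d}]$, for all input labellings and all assignments of unique identifiers from $\{1,\dots,n^a\}$,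 applying $\mathcal{A}$ to the $f(n)$-hop neighbourhood of every vertex gives a $\Pi$-coloring. A uniform local algorithm $\mathcal{A}=(\mathcal{C},g)$ consists of a collection $\mathcal{C}$ of finite-radius rooted grids labelled with $\Sigma_{in}$ and with random labels in $[0,1]$, and a map $g:\mathcal{C}\to\Sigma_{out}$, both measurable in the random labels. Given i.i.d. uniform labels on $\mathbb{Z}^d$ and an input labelling, a vertex scans neighbourhoods of radius $0,1,2,\dots$ until one lies in $\mathcal{C}$, and outputs the value of $g$ there; the first such radius, at the origin, is the coding radius $R_{\mathcal{A}}$. The algorithm solves $\Pi$ if, for every input labelling of $\mathbb{Z}^d$, with probability $1$ every vertex stops and the outputs form a $\Pi$-coloring. We say $\Pi\in\mathsf{ULOCAL}(O(\log^* 1/\varepsilon))$ if some uniform local algorithm solves $\Pi$ and, for some function $t(\varepsilon)\in\mathbb{N}$ with $t(\varepsilon)=O(\log^* 1/\varepsilon)$ as $\varepsilon\to0^+$, satisfies $\sup P(R_{\mathcal{A}}>t(\varepsilon))\le\varepsilon$ for all $\varepsilon>0$, the supremum being over all input labellings. Then, for every LCL $\Pi$ on $\mathbb{Z}^d$ and every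 choice of $K$ and $a$, $$\Pi\in\mathsf{ULOCAL}(O(\log^* 1/\varepsilon))\iff \Pi\in\mathsf{LOCAL}(O(\log^* n)).$$ Moreover, if $\Pi$ has no inputs, then $\Pi\in\mathsf{LOCAL}(O(\log^* n))$ if and only if $\Pi$ has a finitary factor of i.i.d. (ffiid) solution with tower-function tail decay. That is, there is a measurable translation-equivariant $F:[0,1]^{\mathbb{Z}^d}\to\Sigma_{out}^{\mathbb{Z}^d}$ such that, for i.i.d. uniform labels, $F(x)$ is a $\Pi$-coloring with probability $1$; the least radius $R_F(x)$ (or $\infty$) of a ball around $\mathbf{0}$ whose labels determine $F(x)(\mathbf{0})$ is almost surely finite; and for some $b>0$ we have $P(R_F>r)\le 1/\mathrm{tower}(\lfloor br\rfloor)$ for all large $r$, where $\mathrm{tower}(0)=1$ and $\mathrm{tower}(k+1)=2^{\mathrm{tower}(k)}$. -/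

import Mathlib

open Filter Topology Asymptotics MeasureTheory
open scoped ENNReal

/-! Locally checkable problems on the grid `ℤ^d`, deterministic local algorithms on oriented
tori, uniform local algorithms, and finitary factors of iid processes. -/

namespace GridLCL

/-! ### Growth functions -/

/-- The iterated logarithm: the least number of times `log₂` has to be applied to `x` to reach a
value that is at most `1`. -/
noncomputable def logStar (x : ℝ) : ℕ :=
  sInf {k : ℕ | (Real.logb 2)^[k] x ≤ 1}

/-- The number of iterations in the definition of `logStar` is always finite. -/
theorem logStar_set_nonempty (x : ℝ) : {k : ℕ | (Real.logb 2)^[k] x ≤ 1}.Nonempty := by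
  have key : ∀ (m : ℕ) (y : ℝ), y ≤ m + 1 → ∃ k : ℕ, (Real.logb 2)^[k] y ≤ 1 := by
    intro m
    induction m with
    | zero => intro y hy; exact ⟨0, by simpa using hy⟩
    | succ m ih =>
      intro y hy
      rcases le_or_gt y 2 with h2 | h2
      · rcases le_or_gt y 1 with h1 | h1
        · exact ⟨0, by simpa using h1⟩
        · refine ⟨1, ?_⟩
          have := Real.logb_le_logb_of_le (b := 2) (by norm_num) (by linarith) h2
          simpa using this
      · have hl : Real.logb 2 y ≤ y - 1 := by
          have e : Real.logb 2 y = 1 + Real.logb 2 (y / 2) := by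
            rw [Real.logb_div (by linarith) (by norm_num)]
            simp
          have h3 : Real.logb 2 (y / 2) ≤ y - 2 := by
            rw [Real.logb, div_le_iff₀ (Real.log_pos (by norm_num))]
            have h4 := Real.log_le_sub_one_of_pos (show 0 < y / 2 by linarith)
            have h5 : (0.5 : ℝ) < Real.log 2 := by
              have := Real.log_two_gt_d9
              linarith
            nlinarith
          linarith
        obtain ⟨k, hk⟩ := ih (Real.logb 2 y) (by push_cast at hy; linarith)
        exact ⟨k + 1, by simpa [Function.iterate_succ] using hk⟩
  obtain ⟨m, hm⟩ := exists_nat_ge x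
  exact key m x (by linarith)

/-- The tower function: `tower 0 = 1` and `tower (k + 1) = 2 ^ tower k`. -/
def tower : ℕ → ℕ
  | 0 => 1
  | k + 1 => 2 ^ tower k

/-! ### Grids, tori and neighbourhoods -/

/-- The vertices of the infinite grid. -/
abbrev Grid (d : ℕ) : Type := Fin d → ℤ

/-- The vertices of the torus with side lengths `m i` (meaningful when all `m i` are positive). -/
abbrev Torus {d : ℕ} (m : Fin d → ℕ) : Type := (i : Fin d) → ZMod (m i)

/-- The ball of radius `r` around the origin of the grid. The graph distance of the standard Cayley
graph of `ℤ^d` is the `ℓ¹` distance. Since the edges are oriented and labelled by the standard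
generators, a rooted grid of radius `r` with labels in `L` is the same as a function
`Ball d r → L`. -/
abbrev Ball (d r : ℕ) : Type := {z : Grid d // ∑ i, |z i| ≤ (r : ℤ)}

/-- Walking in the grid from `v` along the displacement `z`. -/
def gridMove {d : ℕ} (v : Grid d) (z : Grid d) : Grid d := v + z

/-- Walking in the torus from `v` along the displacement `z`. -/
def torusMove {d : ℕ} (m : Fin d → ℕ) (v : Torus m) (z : Grid d) : Torus m :=
  fun i => v i + (z i : ZMod (m i))

/-- The `r`-hop neighbourhood of `v`, with the labels given by `c`, in a graph whose
oriented labelled edges are described by `move`. -/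
def view {d : ℕ} {V L : Type*} (move : V → Grid d → V) (c : V → L) (v : V) (r : ℕ) :
    Ball d r → L :=
  fun z => c (move v z.1)

/-! ### Locally checkable problems -/

/-- An LCL on `ℤ^d` with input labels `I` and output labels `O`: a radius and a set of
allowed rooted labelled grids of that radius. -/
structure LCL (d : ℕ) (I O : Type*) where
  /-- the checking radius -/
  radius : ℕ
  /-- the allowed labelled neighbourhoods -/
  allowed : Set (Ball d radius → I × O)

/-- The output labelling `c`, together with the input labelling `x`, is a `P`-colouring. -/
def LCL.IsColoring {d : ℕ} {I O V : Type*} (P : LCL d I O) (move : V → Grid d → V)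
    (x : V → I) (c : V → O) : Prop :=
  ∀ v : V, view move (fun u => (x u, c u)) v P.radius ∈ P.allowed

/-! ### Deterministic local algorithms -/

/-- A deterministic local algorithm of local complexity `f`: given `n` and a rooted grid of
radius `f n` labelled with identifiers and input labels, it returns an output label. -/
abbrev LocalAlgorithm (d : ℕ) (I O : Type*) (f : ℕ → ℕ) : Type _ :=
  (n : ℕ) → (Ball d (f n) → ℕ) → (Ball d (f n) → I) → O

/-- The torus with side lengths `m` has `n` vertices, and its side lengths are `Θ(n^{1/d})`,
with constant `K`. -/
def IsTorusOfSize {d : ℕ} (K : ℝ) (m : Fin d → ℕ) (n : ℕ) : Prop :=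
  (∀ i, 0 < m i) ∧ ∏ i, m i = n ∧
    ∀ i, (m i : ℝ) ≤ K * (n : ℝ) ^ (1 / (d : ℝ)) ∧ (n : ℝ) ^ (1 / (d : ℝ)) ≤ K * (m i : ℝ)

/-- The output labelling obtained by applying the algorithm at every vertex of a torus. -/
def LocalAlgorithm.run {d : ℕ} {I O : Type*} {f : ℕ → ℕ} (A : LocalAlgorithm d I O f) (n : ℕ)
    (m : Fin d → ℕ) (ident : Torus m → ℕ) (x : Torus m → I) : Torus m → O :=
  fun v => A n (view (torusMove m) ident v (f n)) (view (torusMove m) x v (f n))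

/-- `P ∈ LOCAL(f(n))`: some algorithm of local complexity `f` solves `P`, for every large enough
`n`, on every `n`-vertex torus of side lengths `Θ(n^{1/d})` (with constant `K`), for all input
labellings and all assignments of unique identifiers from `{1, …, n ^ a}`. -/
def LCL.InLOCAL {d : ℕ} {I O : Type*} (P : LCL d I O) (K : ℝ) (a : ℕ) (f : ℕ → ℕ) : Prop :=
  ∃ A : LocalAlgorithm d I O f, ∀ᶠ n : ℕ in atTop, ∀ m : Fin d → ℕ, IsTorusOfSize K m n →
    ∀ ident : Torus m → ℕ, Function.Injective ident → (∀ v, 1 ≤ ident v ∧ ident v ≤ n ^ a) →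
      ∀ x : Torus m → I, P.IsColoring (torusMove m) x (A.run n m ident x)

/-- `P ∈ LOCAL(O(log* n))`. -/
def LCL.InLOCALLogStar {d : ℕ} {I O : Type*} (P : LCL d I O) (K : ℝ) (a : ℕ) : Prop :=
  ∃ f : ℕ → ℕ, (fun n => (f n : ℝ)) =O[atTop] (fun n : ℕ => (logStar (n : ℝ) : ℝ)) ∧
    P.InLOCAL K a f

/-! ### Uniform local algorithms -/

/-- Assignments of random strings, modelled as elements of `[0,1]`, to the grid vertices. -/
abbrev Randomness (d : ℕ) : Type := Grid d → unitInterval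

/-- The law of iid uniform labels of the grid. -/
noncomputable def iidLaw (d : ℕ) : Measure (Randomness d) :=
  Measure.infinitePi (fun _ : Grid d => (volume : Measure unitInterval))

/-- A uniform local algorithm. `rule r x ω` is its decision on the rooted grid of radius `r` with
input labels `x` and random labels `ω`: `some o` if that labelled rooted grid belongs to
the collection on which the algorithm stops, with output `o`, and `none` if the algorithm has to
look further. -/
structure UniformAlgorithm (d : ℕ) (I O : Type*) where
  /-- the decision on a labelled rooted grid of radius `r` -/
  rule : (r : ℕ) → (Ball d r → I) → (Ball d r → unitInterval) → Option O
  measurable_rule : ∀ (r : ℕ) (x : Ball d r → I) (o : Option O), MeasurableSet {ω | rule r x ω = o}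

namespace UniformAlgorithm

variable {d : ℕ} {I O : Type*} (A : UniformAlgorithm d I O)

/-- The decision of the algorithm at vertex `v` after scanning its `r`-hop neighbourhood. -/
def decision (x : Grid d → I) (ω : Randomness d) (v : Grid d) (r : ℕ) : Option O :=
  A.rule r (view gridMove x v r) (view gridMove ω v r)

/-- The coding radius at `v`: the least radius at which the algorithm stops, `⊤` if there is
none. -/
noncomputable def codingRadius (x : Grid d → I) (ω : Randomness d) (v : Grid d) : ℕ∞ :=
  ⨅ (r : ℕ) (_ : (A.decision x ω v r).isSome), (r : ℕ∞)

open Classical in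
/-- The output at `v`, i.e. the decision at the first radius at which the algorithm stops;
`none` if it never stops. -/
noncomputable def output (x : Grid d → I) (ω : Randomness d) (v : Grid d) : Option O :=
  if h : ∃ r, (A.decision x ω v r).isSome then A.decision x ω v (Nat.find h) else none

/-- The algorithm solves `P`: for every input labelling of the grid, with probability `1` it stops
at every vertex and the outputs form a `P`-colouring. -/
def Solves (P : LCL d I O) : Prop :=
  ∀ x : Grid d → I, ∀ᵐ ω ∂(iidLaw d),
    ∃ c : Grid d → O, (∀ v, A.output x ω v = some (c v)) ∧ P.IsColoring gridMove x c

/-- `P(R_A > r)`, as a supremum over all input labellings. -/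
noncomputable def tail (r : ℕ) : ℝ≥0∞ :=
  ⨆ x : Grid d → I, iidLaw d {ω | (r : ℕ∞) < A.codingRadius x ω 0}

end UniformAlgorithm

/-- `P ∈ ULOCAL(t(ε))`. -/
def LCL.InULOCAL {d : ℕ} {I O : Type*} (P : LCL d I O) (t : ℝ → ℕ) : Prop :=
  ∃ A : UniformAlgorithm d I O, A.Solves P ∧ ∀ ε : ℝ, 0 < ε → A.tail (t ε) ≤ ENNReal.ofReal ε

/-- `P ∈ ULOCAL(O(log* 1/ε))`. -/
def LCL.InULOCALLogStar {d : ℕ} {I O : Type*} (P : LCL d I O) : Prop :=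
  ∃ t : ℝ → ℕ, (fun ε => (t ε : ℝ)) =O[𝓝[>] (0 : ℝ)] (fun ε : ℝ => (logStar (1 / ε) : ℝ)) ∧
    P.InULOCAL t

/-! ### Finitary factors of iid processes -/

/-- The coding radius of a map `F` between labellings of the grid: the least `r` such that the
labels in the ball of radius `r` around the origin determine the value of `F` at the origin. -/
noncomputable def factorRadius {d : ℕ} {O : Type*} (F : Randomness d → Grid d → O)
    (ω : Randomness d) : ℕ∞ :=
  ⨅ (r : ℕ) (_ : ∀ ω' : Randomness d, (∀ z : Ball d r, ω' z.1 = ω z.1) → F ω' 0 = F ω 0),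
    (r : ℕ∞)

/-- `F` is a finitary factor of iid: measurable, equivariant under translations, and almost surely
its value at the origin is determined by the labels in a finite neighbourhood. (By
equivariance, measurability of the value at the origin is enough.) -/
structure IsFFIID {d : ℕ} {O : Type*} (F : Randomness d → Grid d → O) : Prop where
  measurable : ∀ o : O, MeasurableSet {ω | F ω 0 = o}
  equivariant : ∀ (g : Grid d) (ω : Randomness d),
    F (fun h => ω (g + h)) = fun h => F ω (g + h)
  finitary : ∀ᵐ ω ∂(iidLaw d), factorRadius F ω < ⊤

/-- The coding radius of `F` has tower-function tail decay. -/
def HasTowerTail {d : ℕ} {O : Type*} (F : Randomness d → Grid d → O) : Prop :=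
  ∃ b : ℝ, 0 < b ∧ ∀ᶠ r : ℕ in atTop,
    iidLaw d {ω | (r : ℕ∞) < factorRadius F ω} ≤ ((tower ⌊b * (r : ℝ)⌋₊ : ℕ) : ℝ≥0∞)⁻¹

/-- `P` admits a finitary factor of iid solution with tower-function tail decay. -/
def LCL.HasTowerFFIID {d : ℕ} {I O : Type*} (P : LCL d I O) : Prop :=
  ∃ F : Randomness d → Grid d → O, IsFFIID F ∧ HasTowerTail F ∧
    ∀ x : Grid d → I, ∀ᵐ ω ∂(iidLaw d), P.IsColoring gridMove x (F ω)

end GridLCL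

namespace GridLCL

/-! ### The tower function and the iterated logarithm -/

/-! Both notions of complexity reduce to one condition, `HasTowerDecay`: up to rescaling the radius
by a constant, the probability of not having stopped by radius `j` is at most `1 / tower j`.

From uniform to deterministic, derandomise (`exists_labels_of_identifiers`). Truncated at radius `C
* (log* n + 2)`, the algorithm fails near a vertex with probability at most a constant times `2 ^
(-2 ^ n)`. The relevant ball embeds in the torus and has at most `n` vertices, so it carries at most
`((n ^ a + 1) * |I|) ^ n` configurations of identifiers and inputs. By a union bound, one map from
identifiers to `[0,1]` makes the algorithm succeed on all of them.

From deterministic to uniform, fix a single large `n`. The algorithm for this `n` has constant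
radius, and it cannot tell identifiers from a colouring with fewer than `n` colours in which nearby
vertices differ: every coloured ball of the grid extends to a torus with honest identifiers
(`isColoring_of_distance_coloring`). It remains to build such colourings as factors of iid with
tower tails (`exists_distance_coloring`). A vertex takes as its colour the shortest initial piece of
its label that separates it from its neighbours. Cole–Vishkin rounds bring this below a constant,
the number of rounds at a vertex being governed by its own colour only. A greedy colouring, ordered
by round and then by reduced colour, finishes. Needing `tower j` digits has probability about `1 /
tower (j + 1)` and costs about `j` rounds.

A factor of iid gives a uniform algorithm once "the ball determines the value" is replaced by a
measurable stopping rule (`exists_measurable_decision`). Conversely, without inputs the output of a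
uniform algorithm is itself a factor of the labels. -/

theorem tower_strictMono : StrictMono tower :=
  strictMono_nat_of_lt_succ fun _ => Nat.lt_two_pow_self

theorem lt_tower (j : ℕ) : j < tower j := by
  induction j with
  | zero => simp [tower]
  | succ j ih => exact lt_of_le_of_lt ih (tower_strictMono (Nat.lt_succ_self j))

theorem tower_pos (j : ℕ) : 0 < tower j := lt_of_le_of_lt (Nat.zero_le _) (lt_tower j)

theorem le_tower_of_iterate_logb_le {k : ℕ} {x : ℝ} (h : (Real.logb 2)^[k] x ≤ 1) :
    x ≤ tower k := by
  induction k generalizing x with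
  | zero => simpa [tower] using h
  | succ k ih =>
    rcases le_or_gt x 0 with hx | hx
    · exact hx.trans (by positivity)
    · have h1 := ih (x := Real.logb 2 x) (by simpa [Function.iterate_succ] using h)
      rw [Real.logb_le_iff_le_rpow (by norm_num) hx] at h1
      simpa [tower] using h1

theorem le_tower_logStar (x : ℝ) : x ≤ tower (logStar x) :=
  le_tower_of_iterate_logb_le (Nat.sInf_mem (logStar_set_nonempty x))

theorem logStar_le_of_le_tower {k : ℕ} {x : ℝ} (h : x ≤ tower k) : logStar x ≤ k := by
  suffices ∃ i ≤ k, (Real.logb 2)^[i] x ≤ 1 by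
    obtain ⟨i, hi, hx⟩ := this
    exact (Nat.sInf_le hx).trans hi
  induction k generalizing x with
  | zero => exact ⟨0, le_rfl, by simpa [tower] using h⟩
  | succ k ih =>
    rcases le_or_gt x 1 with hx | hx
    · exact ⟨0, Nat.zero_le _, by simpa using hx⟩
    · obtain ⟨i, hi, h1⟩ := ih (x := Real.logb 2 x) (by
        rw [Real.logb_le_iff_le_rpow (by norm_num) (by linarith)]
        simpa [tower] using h)
      exact ⟨i + 1, by omega, by simpa [Function.iterate_succ] using h1⟩

theorem logStar_le_iff {k : ℕ} {x : ℝ} : logStar x ≤ k ↔ x ≤ tower k :=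
  ⟨fun h => (le_tower_logStar x).trans (by exact_mod_cast tower_strictMono.monotone h),
    logStar_le_of_le_tower⟩

/-- The iterated logarithm is dominated by the logarithm. -/
theorem logStar_le_log {n : ℕ} : logStar (n : ℝ) ≤ Nat.clog 2 n + 1 := by
  refine logStar_le_of_le_tower ?_
  have h1 : n ≤ 2 ^ Nat.clog 2 n := Nat.le_pow_clog (by norm_num) n
  have h2 : 2 ^ Nat.clog 2 n ≤ tower (Nat.clog 2 n + 1) :=
    Nat.pow_le_pow_right (by norm_num) (lt_tower _).le
  exact_mod_cast h1.trans h2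

theorem tendsto_inv_tower : Tendsto (fun j => ((tower j : ℕ) : ℝ)⁻¹) atTop (𝓝[>] 0) := by
  refine tendsto_nhdsWithin_iff.2 ⟨?_, Eventually.of_forall fun j => ?_⟩
  · exact tendsto_inv_atTop_zero.comp
      (tendsto_natCast_atTop_atTop.comp tower_strictMono.tendsto_atTop)
  · have := tower_pos j
    simp only [Set.mem_Ioi]
    positivity

/-! ### Tower-function decay -/

/-- The function `p` decays at least as fast as `r ↦ 1 / tower (r / C)` for some constant `C`. -/
def HasTowerDecay (p : ℕ → ℝ≥0∞) : Prop :=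
  ∃ C : ℕ, ∀ᶠ j : ℕ in atTop, p (C * j) ≤ ((tower j : ℕ) : ℝ≥0∞)⁻¹

theorem hasTowerDecay_iff_floor {p : ℕ → ℝ≥0∞} (hp : Antitone p) :
    HasTowerDecay p ↔
      ∃ b : ℝ, 0 < b ∧ ∀ᶠ r : ℕ in atTop, p r ≤ ((tower ⌊b * (r : ℝ)⌋₊ : ℕ) : ℝ≥0∞)⁻¹ := by
  constructor
  · rintro ⟨C, hC⟩
    -- `C` may be `0`, hence the shift by one before inverting.
    refine ⟨((C + 1 : ℕ) : ℝ)⁻¹, by positivity, ?_⟩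
    have h1 : Tendsto (fun r : ℕ => r / (C + 1)) atTop atTop :=
      Nat.tendsto_div_const_atTop (by omega)
    filter_upwards [h1.eventually hC] with r hr
    have h2 : ⌊((C + 1 : ℕ) : ℝ)⁻¹ * (r : ℝ)⌋₊ = r / (C + 1) := by
      rw [inv_mul_eq_div, Nat.floor_div_natCast, Nat.floor_natCast]
    rw [h2]
    refine (hp ?_).trans hr
    calc C * (r / (C + 1)) ≤ (C + 1) * (r / (C + 1)) := Nat.mul_le_mul_right _ (by omega)
      _ ≤ r := Nat.mul_div_le _ _
  · rintro ⟨b, hb, h⟩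
    refine ⟨⌈b⁻¹⌉₊, ?_⟩
    have hpos : 0 < ⌈b⁻¹⌉₊ := Nat.ceil_pos.2 (by positivity)
    have h1 : Tendsto (fun j : ℕ => ⌈b⁻¹⌉₊ * j) atTop atTop :=
      tendsto_id.const_mul_atTop' hpos
    filter_upwards [h1.eventually h] with j hj
    refine hj.trans (ENNReal.inv_le_inv.2 ?_)
    have : j ≤ ⌊b * ((⌈b⁻¹⌉₊ * j : ℕ) : ℝ)⌋₊ := by
      refine Nat.le_floor ?_
      have h2 : 1 ≤ b * ⌈b⁻¹⌉₊ := by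
        have := mul_le_mul_of_nonneg_left (Nat.le_ceil b⁻¹) hb.le
        rwa [mul_inv_cancel₀ hb.ne'] at this
      push_cast
      nlinarith [Nat.cast_nonneg (α := ℝ) j]
    exact_mod_cast tower_strictMono.monotone this

/-- `logStar` and `tower` form a Galois connection (`logStar_le_iff`), so the two sides translate
into each other by sampling at `ε = 1 / tower j`. -/
theorem hasTowerDecay_iff_logStar {p : ℕ → ℝ≥0∞} (hp : Antitone p) :
    HasTowerDecay p ↔
      ∃ t : ℝ → ℕ, (fun ε => (t ε : ℝ)) =O[𝓝[>] (0 : ℝ)] (fun ε : ℝ => (logStar (1 / ε) : ℝ)) ∧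
        ∀ ε : ℝ, 0 < ε → p (t ε) ≤ ENNReal.ofReal ε := by
  constructor
  · rintro ⟨C, hC⟩
    obtain ⟨j₀, hj₀⟩ := eventually_atTop.1 hC
    -- The bound is required for every `ε > 0`, but the decay is only known from `j₀` on; the
    -- maximum bridges this and is inactive near `0`.
    refine ⟨fun ε => C * max j₀ (logStar (1 / ε)), ?_, fun ε hε => ?_⟩
    · refine IsBigO.of_bound C ?_
      have h1 : Tendsto (fun ε : ℝ => 1 / ε) (𝓝[>] 0) atTop := by
        simpa using tendsto_inv_nhdsGT_zero (𝕜 := ℝ)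
      filter_upwards [h1.eventually_gt_atTop ((tower j₀ : ℕ) : ℝ)] with ε hε
      have h2 : j₀ < logStar (1 / ε) := by
        by_contra h
        exact absurd (logStar_le_iff.1 (not_lt.1 h)) (not_le.2 hε)
      rw [max_eq_right h2.le]
      simp
    · refine (hj₀ _ (le_max_left _ _)).trans ?_
      have h1 : 1 / ε ≤ tower (max j₀ (logStar (1 / ε))) := logStar_le_iff.1 (le_max_right _ _)
      rw [← inv_inv ε, ENNReal.ofReal_inv_of_pos (by positivity)]
      refine ENNReal.inv_le_inv.2 ?_
      rw [← ENNReal.ofReal_natCast]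
      exact ENNReal.ofReal_le_ofReal (by simpa using h1)
  · rintro ⟨t, ht, h⟩
    obtain ⟨c, hc⟩ := ht.bound
    refine ⟨⌈c⌉₊, ?_⟩
    filter_upwards [tendsto_inv_tower.eventually hc] with j hj
    have hpos : (0 : ℝ) < (tower j : ℕ) := by exact_mod_cast tower_pos j
    have h1 := h _ (inv_pos.2 hpos)
    rw [ENNReal.ofReal_inv_of_pos hpos, ENNReal.ofReal_natCast] at h1
    refine (hp ?_).trans h1
    have h2 : logStar ((1 : ℝ) / ((tower j : ℕ) : ℝ)⁻¹) ≤ j := logStar_le_iff.2 (by simp)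
    simp only [Real.norm_natCast] at hj
    have h3 : (t ((tower j : ℕ) : ℝ)⁻¹ : ℝ) ≤ (⌈c⌉₊ * j : ℕ) := by
      push_cast
      calc _ ≤ _ := hj
        _ ≤ (⌈c⌉₊ : ℝ) * (logStar ((1 : ℝ) / ((tower j : ℕ) : ℝ)⁻¹)) := by
          gcongr
          exact Nat.le_ceil c
        _ ≤ _ := by gcongr
    exact_mod_cast h3

theorem UniformAlgorithm.antitone_tail {d : ℕ} {I O : Type*} (A : UniformAlgorithm d I O) :
    Antitone A.tail := fun _ _ hrs =>
  iSup_mono fun _ => measure_mono fun _ hω => (Nat.cast_le.2 hrs).trans_lt (Set.mem_ofPred.1 hω)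

theorem inULOCALLogStar_iff {d : ℕ} {I O : Type*} (P : LCL d I O) :
    P.InULOCALLogStar ↔ ∃ A : UniformAlgorithm d I O, A.Solves P ∧ HasTowerDecay A.tail := by
  constructor
  · rintro ⟨t, ht, A, hA, h⟩
    exact ⟨A, hA, (hasTowerDecay_iff_logStar A.antitone_tail).2 ⟨t, ht, h⟩⟩
  · rintro ⟨A, hA, h⟩
    obtain ⟨t, ht, h⟩ := (hasTowerDecay_iff_logStar A.antitone_tail).1 h
    exact ⟨t, ht, A, hA, h⟩

theorem hasTowerTail_iff {d : ℕ} {O : Type*} (F : Randomness d → Grid d → O) :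
    HasTowerTail F ↔ HasTowerDecay fun r => iidLaw d {ω | (r : ℕ∞) < factorRadius F ω} :=
  (hasTowerDecay_iff_floor (p := fun r => iidLaw d {ω | (r : ℕ∞) < factorRadius F ω})
    fun _ _ hrs => measure_mono fun _ hω =>
      (Nat.cast_le.2 hrs).trans_lt (Set.mem_ofPred.1 hω)).symm

/-! ### The law of the random labels -/

instance (d : ℕ) : IsProbabilityMeasure (iidLaw d) := by
  unfold iidLaw; infer_instance

/-- Reading iid labels through an injection gives iid labels. It serves twice: for translations of
the grid, and for labels looked up by unique identifiers. -/
theorem map_infinitePi_comp_injective {α β X : Type*} [MeasurableSpace X] (μ : Measure X)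
    [IsProbabilityMeasure μ] {j : α → β} (hj : Function.Injective j) :
    (Measure.infinitePi fun _ : β => μ).map (fun ω a => ω (j a)) =
      Measure.infinitePi fun _ : α => μ := by
  classical
  refine Measure.eq_infinitePi _ fun s t ht => ?_
  have hm : Measurable fun (ω : β → X) (a : α) => ω (j a) := by fun_prop
  rw [Measure.map_apply hm (MeasurableSet.pi s.countable_toSet fun i _ => ht i)]
  let t' : β → Set X := fun b => if h : ∃ a, j a = b then t h.choose else Set.univ
  have ht' : ∀ a, t' (j a) = t a := fun a => by
    have h : ∃ a', j a' = j a := ⟨a, rfl⟩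
    simp only [t', dif_pos h]
    rw [hj h.choose_spec]
  have hpre : (fun (ω : β → X) (a : α) => ω (j a)) ⁻¹' (Set.pi s t) =
      Set.pi (s.image j : Finset β) t' := by
    ext ω
    simp [Set.mem_pi, ht']
  rw [hpre, Measure.infinitePi_pi, Finset.prod_image hj.injOn]
  · simp [ht']
  · intro b hb
    obtain ⟨a, -, rfl⟩ := Finset.mem_image.1 hb
    rw [ht']
    exact ht a

theorem measurePreserving_shift {d : ℕ} (v : Grid d) :
    MeasurePreserving (fun (ω : Randomness d) (h : Grid d) => ω (v + h)) (iidLaw d) (iidLaw d) :=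
  ⟨by fun_prop, map_infinitePi_comp_injective _ (add_right_injective v)⟩

open Classical in
/-- The labelling which is `u` on the ball of radius `r` and `η` elsewhere. -/
noncomputable def glue {d r : ℕ} {L : Type*} (u : Ball d r → L) (η : Grid d → L) : Grid d → L :=
  fun z => if h : ∑ i, |z i| ≤ (r : ℤ) then u ⟨z, h⟩ else η z

theorem glue_apply_ball {d r : ℕ} {L : Type*} (u : Ball d r → L) (η : Grid d → L)
    (z : Ball d r) : glue u η z.1 = u z := by
  simp [glue, z.2]

theorem measurable_glue {d r : ℕ} :
    Measurable fun p : (Ball d r → unitInterval) × Randomness d => glue p.1 p.2 := by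
  refine measurable_pi_lambda _ fun z => ?_
  by_cases h : ∑ i, |z i| ≤ (r : ℤ)
  · simp only [glue, dif_pos h]; fun_prop
  · simp only [glue, dif_neg h]; fun_prop

/-- Resampling all labels outside a ball preserves the law. Conditioning on the labels in the ball
thereby becomes an application of Fubini. -/
theorem measurePreserving_glue {d : ℕ} (r : ℕ) :
    MeasurePreserving
      (fun p : Randomness d × Randomness d => glue (fun z : Ball d r => p.1 z.1) p.2)
      ((iidLaw d).prod (iidLaw d)) (iidLaw d) := by
  classical
  have hm : Measurable
      fun p : Randomness d × Randomness d => glue (fun z : Ball d r => p.1 z.1) p.2 := by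
    have h : Measurable fun p : Randomness d × Randomness d =>
        ((fun z : Ball d r => p.1 z.1), p.2) :=
      (measurable_pi_lambda _ fun z => (measurable_pi_apply z.1).comp measurable_fst).prodMk
        measurable_snd
    exact measurable_glue.comp h
  refine ⟨hm, Measure.eq_infinitePi _ fun s t ht => ?_⟩
  rw [Measure.map_apply hm (MeasurableSet.pi s.countable_toSet fun i _ => ht i)]
  let p : Grid d → Prop := fun z => ∑ i, |z i| ≤ (r : ℤ)
  have hpre : (fun q : Randomness d × Randomness d => glue (fun z : Ball d r => q.1 z.1) q.2) ⁻¹'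
      (Set.pi s t) = (Set.pi (s.filter p : Finset _) t) ×ˢ
        (Set.pi (s.filter fun z => ¬ p z : Finset _) t) := by
    ext q
    simp only [Set.mem_preimage, Set.mem_pi, Set.mem_prod, Finset.mem_coe, Finset.mem_filter]
    constructor
    · intro h
      refine ⟨fun z hz => ?_, fun z hz => ?_⟩
      · have := h z hz.1
        rwa [glue, dif_pos hz.2] at this
      · have := h z hz.1
        rwa [glue, dif_neg hz.2] at this
    · rintro ⟨h1, h2⟩ z hz
      by_cases hp : p z
      · rw [glue, dif_pos hp]; exact h1 z ⟨hz, hp⟩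
      · rw [glue, dif_neg hp]; exact h2 z ⟨hz, hp⟩
  rw [hpre, Measure.prod_prod, iidLaw, Measure.infinitePi_pi _ fun i _ => ht i,
    Measure.infinitePi_pi _ fun i _ => ht i, Finset.prod_filter_mul_prod_filter_not]

/-! ### Measurable decisions from finitely many labels -/

/-- A countably valued random variable admits, for every radius, a measurable decision rule on
the labels in the ball of that radius, which is almost surely correct and stops whenever these
labels determine the value. -/
theorem exists_measurable_decision {d : ℕ} {S : Type*} [Countable S] (g : Randomness d → S)
    (hg : ∀ s, MeasurableSet {ω | g ω = s}) (r : ℕ) :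
    ∃ D : (Ball d r → unitInterval) → Option S, (∀ o, MeasurableSet {u | D u = o}) ∧
      (∀ ω, (∀ ω' : Randomness d, (∀ z : Ball d r, ω' z.1 = ω z.1) → g ω' = g ω) →
        D (fun z => ω z.1) = some (g ω)) ∧
      ∀ᵐ ω ∂(iidLaw d), ∀ s, D (fun z => ω z.1) = some s → g ω = s := by
  classical
  -- `κ u s` is the conditional probability of the value `s` given the labels `u` in the ball. The
  -- event that the ball determines the value quantifies over uncountably many labellings and need
  -- not be measurable; "some `κ u s` equals `1`" is measurable and weaker.
  let κ : (Ball d r → unitInterval) → S → ℝ≥0∞ := fun u s => iidLaw d {η | g (glue u η) = s}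
  have hset : ∀ s, MeasurableSet
      {p : (Ball d r → unitInterval) × Randomness d | g (glue p.1 p.2) = s} :=
    fun s => measurable_glue (hg s)
  have hsec : ∀ (u : Ball d r → unitInterval) s, MeasurableSet {η | g (glue u η) = s} :=
    fun u s => (measurable_glue.comp (measurable_const.prodMk measurable_id)) (hg s)
  have hκ : ∀ s, Measurable fun u => κ u s := fun s => measurable_measure_prodMk_left (hset s)
  have huniq : ∀ u s s', κ u s = 1 → κ u s' = 1 → s = s' := by
    intro u s s' h h'
    have h1 := (prob_compl_eq_zero_iff (hsec u s)).2 h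
    have h2 := (prob_compl_eq_zero_iff (hsec u s')).2 h'
    have h3 : ∀ᵐ η ∂(iidLaw d), g (glue u η) = s ∧ g (glue u η) = s' := by
      rw [eventually_and]
      exact ⟨h1, h2⟩
    obtain ⟨η, ha, hb⟩ := h3.exists
    exact ha.symm.trans hb
  let D : (Ball d r → unitInterval) → Option S := fun u =>
    if h : ∃ s, κ u s = 1 then some h.choose else none
  have hD : ∀ u s, D u = some s ↔ κ u s = 1 := by
    intro u s
    by_cases h : ∃ s, κ u s = 1
    · simp only [D, dif_pos h, Option.some.injEq]
      exact ⟨fun e => e ▸ h.choose_spec, fun e => huniq u _ _ h.choose_spec e⟩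
    · simp only [D, dif_neg h]
      exact ⟨fun e => by simp at e, fun e => absurd ⟨s, e⟩ h⟩
  have hsome : ∀ s, MeasurableSet {u | D u = some s} := fun s => by
    simp only [hD]
    exact hκ s (measurableSet_singleton 1)
  refine ⟨D, ?_, fun ω h => ?_, ?_⟩
  · rintro (_ | s)
    · have : {u | D u = none} = (⋃ s, {u | D u = some s})ᶜ := by
        ext u
        simp [Option.eq_none_iff_forall_ne_some]
      rw [this]
      exact (MeasurableSet.iUnion hsome).compl
    · exact hsome s
  · rw [hD]
    have : {η | g (glue (fun z : Ball d r => ω z.1) η) = g ω} = Set.univ :=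
      Set.eq_univ_of_forall fun η => h _ fun z => glue_apply_ball _ _ z
    simp only [κ, this, measure_univ]
  · rw [ae_all_iff]
    intro s
    have hmr : Measurable fun (ω : Randomness d) (z : Ball d r) => ω z.1 := by fun_prop
    have hB : MeasurableSet {ω : Randomness d | D (fun z => ω z.1) = some s → g ω = s} := by
      have e : {ω : Randomness d | D (fun z => ω z.1) = some s → g ω = s} =
          ((fun (ω : Randomness d) (z : Ball d r) => ω z.1) ⁻¹' {u | D u = some s})ᶜ ∪
            {ω | g ω = s} := by
        ext ω
        simp [imp_iff_not_or]
      rw [e]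
      exact (hmr (hsome s)).compl.union (hg s)
    have hmp := measurePreserving_glue (d := d) r
    rw [← hmp.map_eq, ae_map_iff hmp.aemeasurable hB]
    rw [Measure.ae_prod_iff_ae_ae]
    · refine Eventually.of_forall fun ω => ?_
      have e : ∀ η, (fun z : Ball d r => glue (fun z : Ball d r => ω z.1) η z.1) =
          fun z => ω z.1 := fun η => funext fun z => glue_apply_ball _ _ z
      simp only [e, hD]
      by_cases hk : κ (fun z => ω z.1) s = 1
      · filter_upwards [(prob_compl_eq_zero_iff (hsec (fun z => ω z.1) s)).2 hk] with η hη _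
        exact hη
      · exact Eventually.of_forall fun η h => absurd h hk
    · exact hmp.measurable hB

/-! ### Coding radii -/

theorem iInf_natCast_le_iff {p : ℕ → Prop} {n : ℕ} :
    (⨅ (r : ℕ) (_ : p r), (r : ℕ∞)) ≤ n ↔ ∃ m ≤ n, p m := by
  constructor
  · intro h
    by_contra! hc
    have : ((n + 1 : ℕ) : ℕ∞) ≤ ⨅ (r : ℕ) (_ : p r), (r : ℕ∞) :=
      le_iInf₂ fun r hr => by
        by_contra hlt
        rw [Nat.cast_le] at hlt
        exact hc r (by omega) hr
    have := this.trans h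
    rw [Nat.cast_le] at this
    omega
  · rintro ⟨m, hm, hp⟩
    exact (iInf₂_le m hp).trans (by exact_mod_cast hm)

section Factors

variable {d : ℕ} {I O S : Type*}

theorem factorRadius_le_iff {F : Randomness d → Grid d → O} {ω : Randomness d} {r : ℕ} :
    factorRadius F ω ≤ r ↔
      ∀ ω' : Randomness d, (∀ z : Ball d r, ω' z.1 = ω z.1) → F ω' 0 = F ω 0 := by
  rw [factorRadius, iInf_natCast_le_iff]
  refine ⟨?_, fun h => ⟨r, le_rfl, h⟩⟩
  rintro ⟨m, hm, h⟩ ω' hω'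
  exact h ω' fun z => hω' ⟨z.1, z.2.trans (by exact_mod_cast hm)⟩

namespace UniformAlgorithm

variable (A : UniformAlgorithm d I O)

theorem codingRadius_le_iff {x : Grid d → I} {ω : Randomness d} {v : Grid d} {r : ℕ} :
    A.codingRadius x ω v ≤ r ↔ ∃ m ≤ r, (A.decision x ω v m).isSome :=
  iInf_natCast_le_iff

theorem output_eq_some {x : Grid d → I} {ω : Randomness d} {v : Grid d} {o : O}
    (h : ∃ r, (A.decision x ω v r).isSome)
    (h' : ∀ r o', A.decision x ω v r = some o' → o' = o) : A.output x ω v = some o := by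
  classical
  rw [output, dif_pos h]
  obtain ⟨o', ho'⟩ := Option.isSome_iff_exists.1 (Nat.find_spec h)
  rw [ho', h' _ _ ho']

/-- Two labelled grids which look the same on the ball of radius `r`, up to which the algorithm
scans, give the same output. -/
theorem output_congr {x x' : Grid d → I} {ω ω' : Randomness d} {v v' : Grid d} {r : ℕ}
    (h : A.codingRadius x ω v ≤ r) (hx : ∀ z : Ball d r, x' (v' + z.1) = x (v + z.1))
    (hω : ∀ z : Ball d r, ω' (v' + z.1) = ω (v + z.1)) :
    A.output x' ω' v' = A.output x ω v := by
  classical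
  obtain ⟨m, hm, hs⟩ := (A.codingRadius_le_iff).1 h
  have key : ∀ i ≤ r, A.decision x' ω' v' i = A.decision x ω v i := by
    intro i hi
    have e1 : view gridMove x' v' i = view gridMove x v i :=
      funext fun z => hx ⟨z.1, z.2.trans (by exact_mod_cast hi)⟩
    have e2 : view gridMove ω' v' i = view gridMove ω v i :=
      funext fun z => hω ⟨z.1, z.2.trans (by exact_mod_cast hi)⟩
    rw [decision, decision, e1, e2]
  have h1 : ∃ r, (A.decision x ω v r).isSome := ⟨m, hs⟩
  have h2 : ∃ r, (A.decision x' ω' v' r).isSome := ⟨m, by rwa [key m hm]⟩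
  have hf : Nat.find h2 = Nat.find h1 := by
    have hle : Nat.find h1 ≤ m := Nat.find_min' h1 hs
    refine le_antisymm (Nat.find_min' h2 ?_) (Nat.find_min' h1 ?_)
    · rw [key _ (hle.trans hm)]; exact Nat.find_spec h1
    · have hle' : Nat.find h2 ≤ m := Nat.find_min' h2 (by rwa [key m hm])
      rw [← key _ (hle'.trans hm)]; exact Nat.find_spec h2
  rw [output, output, dif_pos h2, dif_pos h1, hf,
    key _ ((Nat.find_min' h1 hs).trans hm)]

theorem decision_shift (x : Grid d → I) (ω : Randomness d) (v w : Grid d) (r : ℕ) :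
    A.decision (fun h => x (v + h)) (fun h => ω (v + h)) w r = A.decision x ω (v + w) r := by
  have e : view gridMove (fun h => x (v + h)) w r = view gridMove x (v + w) r :=
    funext fun z => congrArg x (add_assoc v w z.1).symm
  rw [decision, decision, e]
  exact congrArg _ (funext fun z => congrArg ω (add_assoc v w z.1).symm)

theorem codingRadius_shift (x : Grid d → I) (ω : Randomness d) (v w : Grid d) :
    A.codingRadius (fun h => x (v + h)) (fun h => ω (v + h)) w = A.codingRadius x ω (v + w) := by
  simp only [codingRadius, decision_shift]

theorem output_shift (x : Grid d → I) (ω : Randomness d) (v w : Grid d) :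
    A.output (fun h => x (v + h)) (fun h => ω (v + h)) w = A.output x ω (v + w) := by
  have e : A.decision (fun h => x (v + h)) (fun h => ω (v + h)) w = A.decision x ω (v + w) :=
    funext fun r => A.decision_shift x ω v w r
  rw [output, output, e]

end UniformAlgorithm

/-! ### From factors of iid to uniform algorithms -/

/-- A problem which is solved by a local rule applied to the inputs and to a finitary factor of iid
with tower-function tail decay has a uniform local algorithm. -/
theorem inULOCALLogStar_of_factor [Countable S] (P : LCL d I O) (g : Randomness d → Grid d → S)
    (hg : IsFFIID g)
    (hdecay : HasTowerDecay fun r => iidLaw d {ω | (r : ℕ∞) < factorRadius g ω})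
    (w : ℕ) (h : S → (Ball d w → I) → O)
    (hcol : ∀ x : Grid d → I, ∀ᵐ ω ∂(iidLaw d),
      P.IsColoring gridMove x fun v => h (g ω v) (view gridMove x v w)) :
    P.InULOCALLogStar := by
  choose D hDm hDs hDae using exists_measurable_decision (fun ω => g ω 0) hg.measurable
  let A : UniformAlgorithm d I O :=
    -- The rule waits for radius `w`, where the inputs needed by `h` become visible.
    { rule := fun r x u => if hw : w ≤ r then
          (D r u).map fun s => h s fun z : Ball d w => x ⟨z.1, z.2.trans (by exact_mod_cast hw)⟩
        else none
      measurable_rule := by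
        intro r x o
        by_cases hw : w ≤ r
        · simp only [dif_pos hw]
          let T : Set (Option S) := {p | p.map (fun s => h s fun z : Ball d w =>
            x ⟨z.1, z.2.trans (by exact_mod_cast hw)⟩) = o}
          have e : {u | (D r u).map (fun s => h s fun z : Ball d w =>
              x ⟨z.1, z.2.trans (by exact_mod_cast hw)⟩) = o} = ⋃ p ∈ T, {u | D r u = p} := by
            ext u
            simp [T]
          rw [e]
          exact MeasurableSet.biUnion T.to_countable fun p _ => hDm r p
        · simp only [dif_neg hw]
          exact MeasurableSet.const _ }
  have hdec : ∀ x ω v r, A.decision x ω v r = if w ≤ r then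
      (D r (fun z => ω (v + z.1))).map fun s => h s (view gridMove x v w) else none := by
    intro x ω v r
    by_cases hw : w ≤ r
    · simp only [UniformAlgorithm.decision, A, dif_pos hw, if_pos hw]
      rfl
    · simp only [UniformAlgorithm.decision, A, dif_neg hw, if_neg hw]
  have hshift : ∀ ω v, g (fun h => ω (v + h)) 0 = g ω v := fun ω v => by
    rw [hg.equivariant]; simp
  have hscan : ∀ x ω v (r : ℕ), w ≤ r → factorRadius g (fun h => ω (v + h)) ≤ r →
      (A.decision x ω v r).isSome := by
    intro x ω v r hw hr
    have := hDs r (fun h => ω (v + h)) (factorRadius_le_iff.1 hr)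
    rw [hdec, if_pos hw, this]
    rfl
  rw [inULOCALLogStar_iff]
  refine ⟨A, fun x => ?_, ?_⟩
  · have h1 : ∀ᵐ ω ∂(iidLaw d), ∀ v r s, D r (fun z => ω (v + z.1)) = some s → g ω v = s := by
      rw [ae_all_iff]
      intro v
      rw [ae_all_iff]
      intro r
      filter_upwards [(measurePreserving_shift v).quasiMeasurePreserving.ae (hDae r)] with ω hω s hs
      rw [← hshift]
      exact hω s hs
    have h2 : ∀ᵐ ω ∂(iidLaw d), ∀ v, factorRadius g (fun h => ω (v + h)) < ⊤ := by
      rw [ae_all_iff]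
      exact fun v => (measurePreserving_shift v).quasiMeasurePreserving.ae hg.finitary
    filter_upwards [h1, h2, hcol x] with ω h1 h2 h3
    refine ⟨_, fun v => ?_, h3⟩
    refine A.output_eq_some ?_ fun r o ho => ?_
    · obtain ⟨n, hn⟩ := ENat.ne_top_iff_exists.1 (h2 v).ne
      exact ⟨max w n, hscan x ω v _ (le_max_left _ _)
        (hn ▸ (by exact_mod_cast le_max_right w n))⟩
    · rw [hdec] at ho
      split_ifs at ho
      obtain ⟨s, hs, rfl⟩ := Option.map_eq_some_iff.1 ho
      rw [h1 v r s hs]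
  · obtain ⟨C, hC⟩ := hdecay
    -- With `C + 1` in place of `C`, the scanned radius is at least `j`, hence at least `w`
    -- eventually.
    refine ⟨C + 1, ?_⟩
    filter_upwards [hC, eventually_ge_atTop w] with j hj hw
    refine (iSup_le fun x => measure_mono fun ω hω => ?_).trans hj
    simp only [Set.mem_ofPred_eq] at hω ⊢
    by_contra hlt
    refine hω.not_ge (A.codingRadius_le_iff.2 ⟨_, le_rfl, hscan x ω 0 _ (by nlinarith) ?_⟩)
    simp only [zero_add]
    exact (not_lt.1 hlt).trans (by exact_mod_cast Nat.mul_le_mul_right j (Nat.le_succ C))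

theorem LCL.HasTowerFFIID.inULOCALLogStar [Countable O] {P : LCL d I O} (h : P.HasTowerFFIID) :
    P.InULOCALLogStar := by
  obtain ⟨F, hF, htail, hcol⟩ := h
  exact inULOCALLogStar_of_factor P F hF ((hasTowerTail_iff F).1 htail) 0 (fun o _ => o) hcol

/-! ### From uniform algorithms without inputs to factors of iid -/

theorem UniformAlgorithm.measurableSet_output (A : UniformAlgorithm d I O) (x : Grid d → I)
    (v : Grid d) (o : Option O) : MeasurableSet {ω | A.output x ω v = o} := by
  classical
  have hdec : ∀ r o, MeasurableSet {ω | A.decision x ω v r = o} := fun r o => by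
    have hm : Measurable fun ω : Randomness d => view gridMove ω v r :=
      measurable_pi_lambda _ fun z => measurable_pi_apply _
    exact hm (A.measurable_rule r _ o)
  have hfirst : ∀ r, MeasurableSet {ω | ∀ m < r, A.decision x ω v m = none} := fun r => by
    have : {ω | ∀ m < r, A.decision x ω v m = none} =
        ⋂ m, ⋂ (_ : m < r), {ω | A.decision x ω v m = none} := by ext; simp
    rw [this]
    exact MeasurableSet.iInter fun m => MeasurableSet.iInter fun _ => hdec m none
  have hnone : {ω | A.output x ω v = none} = ⋂ m, {ω | A.decision x ω v m = none} := by
    ext ω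
    simp only [Set.mem_ofPred_eq, Set.mem_iInter, output]
    split_ifs with h
    · refine ⟨fun e => ?_, fun e => e _⟩
      have := Nat.find_spec h
      rw [e] at this
      simp at this
    · push Not at h
      simpa using h
  rcases o with _ | o
  · rw [hnone]
    exact MeasurableSet.iInter fun m => hdec m none
  · have : {ω | A.output x ω v = some o} = ⋃ r, ({ω | A.decision x ω v r = some o} ∩
        {ω | ∀ m < r, A.decision x ω v m = none}) := by
      ext ω
      simp only [Set.mem_ofPred_eq, Set.mem_iUnion, Set.mem_inter_iff, output]
      constructor
      · intro e
        split_ifs at e with h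
        refine ⟨Nat.find h, e, fun m hm => ?_⟩
        simpa using Nat.find_min h hm
      · rintro ⟨r, hr, hlt⟩
        have h : ∃ r, (A.decision x ω v r).isSome := ⟨r, by simp [hr]⟩
        have e : Nat.find h = r := by
          rw [Nat.find_eq_iff]
          exact ⟨by simp [hr], fun m hm => by simp [hlt m hm]⟩
        rw [dif_pos h, e, hr]
    rw [this]
    exact MeasurableSet.iUnion fun r => (hdec r _).inter (hfirst r)

theorem LCL.InULOCALLogStar.hasTowerFFIID [Subsingleton I] [Nonempty I] {P : LCL d I O}
    (h : P.InULOCALLogStar) : P.HasTowerFFIID := by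
  classical
  obtain ⟨A, hA, hdecay⟩ := (inULOCALLogStar_iff P).1 h
  let x₀ : Grid d → I := fun _ => Classical.arbitrary I
  obtain ⟨ω₀, c₀, -, -⟩ := (hA x₀).exists
  -- The factor must be total, so `o₀` is output where the algorithm never stops, which is a null
  -- event. That `O` is inhabited follows from the existence of a solution.
  let o₀ : O := c₀ 0
  let F : Randomness d → Grid d → O := fun ω v => (A.output x₀ ω v).getD o₀
  have hrad : ∀ ω, factorRadius F ω ≤ A.codingRadius x₀ ω 0 := by
    intro ω
    by_cases htop : A.codingRadius x₀ ω 0 = ⊤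
    · simp [htop]
    obtain ⟨n, hn⟩ := ENat.ne_top_iff_exists.1 htop
    rw [← hn]
    refine factorRadius_le_iff.2 fun ω' hω' => ?_
    simp only [F]
    rw [A.output_congr (v' := 0) hn.symm.le (fun z => rfl) (fun z => by simpa using hω' z)]
  refine ⟨F, ⟨fun o => ?_, fun g ω => ?_, ?_⟩, ?_, fun x => ?_⟩
  · have : {ω | F ω 0 = o} = ⋃ p ∈ ({p | p = some o ∨ (p = none ∧ o₀ = o)} : Set (Option O)),
        {ω | A.output x₀ ω 0 = p} := by
      ext ω
      simp only [Set.mem_ofPred_eq, F, Set.mem_iUnion, exists_prop, exists_eq_right']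
      cases A.output x₀ ω 0 <;> simp
    rw [this]
    refine MeasurableSet.biUnion (Set.Countable.mono ?_
      ((Set.countable_singleton (some o)).union (Set.countable_singleton none)))
      fun p _ => A.measurableSet_output x₀ 0 p
    rintro p (h | h)
    · exact Or.inl h
    · exact Or.inr h.1
  · funext v
    simp only [F]
    rw [← A.output_shift x₀ ω g v]
  · filter_upwards [hA x₀] with ω hω
    obtain ⟨c, hc, -⟩ := hω
    refine (hrad ω).trans_lt ?_
    have h1 : ∃ r, (A.decision x₀ ω 0 r).isSome := by
      by_contra hne
      have := hc 0
      rw [UniformAlgorithm.output, dif_neg hne] at this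
      simp at this
    obtain ⟨r, hr⟩ := h1
    exact (A.codingRadius_le_iff.2 ⟨r, le_rfl, hr⟩).trans_lt (ENat.natCast_lt_top r)
  · rw [hasTowerTail_iff]
    obtain ⟨C, hC⟩ := hdecay
    refine ⟨C, hC.mono fun j hj => le_trans ?_ hj⟩
    exact (measure_mono fun ω hω => (Set.mem_ofPred.1 hω).trans_le (hrad ω)).trans
      (le_iSup (fun x => iidLaw d {ω | ((C * j : ℕ) : ℕ∞) < A.codingRadius x ω 0}) x₀)
  · obtain rfl : x = x₀ := funext fun _ => Subsingleton.elim _ _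
    filter_upwards [hA x₀] with ω hω
    obtain ⟨c, hc, hcol⟩ := hω
    have : F ω = c := funext fun v => by simp [F, hc]
    rwa [this]

end Factors

/-! ### Balls -/

theorem abs_apply_le_of_mem_ball {d r : ℕ} (z : Ball d r) (i : Fin d) : |z.1 i| ≤ r :=
  (Finset.single_le_sum (f := fun i => |z.1 i|) (fun _ _ => abs_nonneg _)
    (Finset.mem_univ i)).trans z.2

theorem injective_ball_coords (d r : ℕ) : Function.Injective fun (z : Ball d r) i =>
    (⟨z.1 i, abs_le.1 (abs_apply_le_of_mem_ball z i)⟩ : Set.Icc (-r : ℤ) r) := fun _ _ e =>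
  Subtype.ext (funext fun i => congrArg Subtype.val (congrFun e i))

instance (d r : ℕ) : Finite (Ball d r) := Finite.of_injective _ (injective_ball_coords d r)

theorem card_ball_le (d r : ℕ) : Nat.card (Ball d r) ≤ (2 * r + 1) ^ d := by
  have h1 := Nat.card_le_card_of_injective _ (injective_ball_coords d r)
  rw [Nat.card_fun, Nat.card_eq_fintype_card (α := Fin d), Fintype.card_fin,
    Nat.card_coe_set_eq, Set.ncard_eq_toFinset_card', Set.toFinset_Icc, Int.card_Icc] at h1
  refine h1.trans (le_of_eq ?_)
  congr 1
  omega

theorem sum_abs_add_le {d r s : ℕ} {z z' : Grid d} (hz : ∑ i, |z i| ≤ (r : ℤ))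
    (hz' : ∑ i, |z' i| ≤ (s : ℤ)) : ∑ i, |(z + z') i| ≤ ((r + s : ℕ) : ℤ) := by
  calc ∑ i, |(z + z') i| ≤ ∑ i, (|z i| + |z' i|) := Finset.sum_le_sum fun i _ => abs_add_le _ _
    _ ≤ _ := by rw [Finset.sum_add_distrib]; push_cast; exact add_le_add hz hz'

theorem torusMove_add {d : ℕ} (m : Fin d → ℕ) (v : Torus m) (z z' : Grid d) :
    torusMove m v (z + z') = torusMove m (torusMove m v z) z' := by
  funext i
  simp [torusMove, add_assoc]

/-- Small balls embed into the torus. -/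
theorem torusMove_injOn_ball {d W : ℕ} {m : Fin d → ℕ} (hm : ∀ i, 2 * W + 1 ≤ m i) (v : Torus m) :
    Function.Injective fun z : Ball d W => torusMove m v z.1 := by
  intro z z' e
  refine Subtype.ext (funext fun i => ?_)
  have h1 := congrFun e i
  simp only [torusMove, add_right_inj] at h1
  rw [ZMod.intCast_eq_intCast_iff_dvd_sub] at h1
  have h2 := abs_le.1 (abs_apply_le_of_mem_ball z i)
  have h3 := abs_le.1 (abs_apply_le_of_mem_ball z' i)
  have h4 := hm i
  have h5 := Int.eq_zero_of_abs_lt_dvd h1 (by rw [abs_lt]; constructor <;> omega)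
  omega

/-! ### Comparison of growth rates -/

theorem tendsto_logStar : Tendsto (fun n : ℕ => logStar (n : ℝ)) atTop atTop := by
  refine tendsto_atTop.2 fun k => ?_
  filter_upwards [eventually_gt_atTop (tower k)] with n hn
  by_contra h
  have := logStar_le_iff.1 (not_le.1 h).le
  exact absurd (by exact_mod_cast this) (not_le.2 hn)

/-- This makes balls of radius `O(log* n)` fit into the tori, and bounds their size by `n`: `log*`
is at most `log₂` plus a constant, which is `o(n ^ (1 / d))`. -/
theorem eventually_logStar_add_le {d : ℕ} (hd : 1 ≤ d) (c e : ℝ) (hc : 0 ≤ c) :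
    ∀ᶠ n : ℕ in atTop, c * (logStar (n : ℝ) : ℝ) + e ≤ (n : ℝ) ^ (1 / (d : ℝ)) := by
  have hd' : (0 : ℝ) < 1 / (d : ℝ) := by
    have : (0 : ℝ) < d := by exact_mod_cast hd
    positivity
  have h1 : (fun x : ℝ => c / Real.log 2 * Real.log x + (2 * c + e)) =o[atTop]
      fun x => x ^ (1 / (d : ℝ)) :=
    ((isLittleO_log_rpow_atTop hd').const_mul_left _).add
      (isLittleO_const_left.2 (Or.inr (tendsto_norm_atTop_atTop.comp (tendsto_rpow_atTop hd'))))
  have h2 := (h1.bound (show (0 : ℝ) < 1 by norm_num)).filter_mono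
    (tendsto_natCast_atTop_atTop (R := ℝ))
  rw [eventually_map] at h2
  filter_upwards [h2, eventually_ge_atTop 1] with n hn hn1
  rw [one_mul, Real.norm_of_nonneg (by positivity : (0 : ℝ) ≤ (n : ℝ) ^ (1 / (d : ℝ)))] at hn
  refine le_trans ?_ ((le_abs_self _).trans hn)
  have h3 : (logStar (n : ℝ) : ℝ) ≤ Real.log n / Real.log 2 + 2 := by
    have h4 : (logStar (n : ℝ) : ℝ) ≤ Nat.clog 2 n + 1 := by exact_mod_cast logStar_le_log
    have h5 : (Nat.clog 2 n : ℝ) ≤ Real.logb 2 n + 1 := by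
      have := Real.natCeil_logb_natCast 2 n
      rw [← this]
      exact (Nat.ceil_lt_add_one (Real.logb_nonneg (by norm_num)
        (by exact_mod_cast hn1))).le
    rw [Real.logb] at h5
    linarith
  have h6 := mul_le_mul_of_nonneg_left h3 hc
  have h7 : c * (Real.log n / Real.log 2 + 2) = c / Real.log 2 * Real.log n + 2 * c := by ring
  linarith

theorem eventually_pow_lt_two_pow (k : ℕ) : ∀ᶠ n : ℕ in atTop, n ^ k < 2 ^ n := by
  have h := tendsto_pow_const_div_const_pow_of_one_lt k (show (1 : ℝ) < 2 by norm_num)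
  filter_upwards [h.eventually_lt_const (show (0 : ℝ) < 1 by norm_num)] with n hn
  rw [div_lt_one (by positivity)] at hn
  exact_mod_cast hn

/-- The number of configurations is at most singly exponential, up to polynomial factors. -/
theorem eventually_config_lt (a b c : ℕ) :
    ∀ᶠ n : ℕ in atTop, ((n ^ a + 1) * b) ^ n * c < 2 ^ 2 ^ n := by
  filter_upwards [eventually_pow_lt_two_pow (a + 1), eventually_pow_lt_two_pow 3,
    eventually_ge_atTop (2 * b + c + 2)] with n h1 h3 hn
  have hna : 1 ≤ n ^ a := Nat.one_le_pow _ _ (by omega)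
  have e1 : (n ^ a + 1) * b ≤ 2 ^ n := by
    have : (n ^ a + 1) * b ≤ n ^ a * n := by nlinarith
    rw [pow_succ] at h1
    omega
  have e2 : c ≤ 2 ^ n := le_trans (by omega) (Nat.lt_two_pow_self (n := n)).le
  calc ((n ^ a + 1) * b) ^ n * c ≤ (2 ^ n) ^ n * 2 ^ n :=
        Nat.mul_le_mul (Nat.pow_le_pow_left e1 n) e2
    _ = 2 ^ (n * n + n) := by rw [← pow_mul, ← pow_add]
    _ < 2 ^ 2 ^ n := Nat.pow_lt_pow_right (by norm_num) (by nlinarith)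

/-! ### Derandomisation -/

section Derandomisation

variable {d : ℕ} {I O : Type*}

/-- The algorithm stops within radius `T` on the checking ball of the origin, and the outputs there
are allowed. -/
def GoodAtOrigin (A : UniformAlgorithm d I O) (P : LCL d I O) (T : ℕ) (o₀ : O) (x : Grid d → I)
    (ω : Randomness d) : Prop :=
  (∀ z : Ball d P.radius, A.codingRadius x ω z.1 ≤ T) ∧
    view gridMove (fun u => (x u, (A.output x ω u).getD o₀)) 0 P.radius ∈ P.allowed

/-- Outside a null set the outputs are correct, so only late stopping in the checking ball matters.
Translating each vertex to the origin also translates the inputs, which the supremum in `tail`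
absorbs. -/
theorem measure_not_goodAtOrigin_le {A : UniformAlgorithm d I O} {P : LCL d I O} (hA : A.Solves P)
    (T : ℕ) (o₀ : O) (x : Grid d → I) :
    iidLaw d {ω | ¬ GoodAtOrigin A P T o₀ x ω} ≤ Nat.card (Ball d P.radius) * A.tail T := by
  have := Fintype.ofFinite (Ball d P.radius)
  have h0 : iidLaw d {ω | ¬ ∃ c : Grid d → O, (∀ v, A.output x ω v = some (c v)) ∧
      P.IsColoring gridMove x c} = 0 := hA x
  have hsub : {ω | ¬ GoodAtOrigin A P T o₀ x ω} ⊆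
      (⋃ z : Ball d P.radius, {ω | (T : ℕ∞) < A.codingRadius x ω z.1}) ∪
        {ω | ¬ ∃ c : Grid d → O, (∀ v, A.output x ω v = some (c v)) ∧
          P.IsColoring gridMove x c} := by
    intro ω hω
    by_contra hc
    simp only [Set.mem_union, Set.mem_iUnion, Set.mem_ofPred_eq, not_or, not_lt, not_exists] at hc
    obtain ⟨h1, hc⟩ := hc
    rw [← not_exists, not_not] at hc
    obtain ⟨c, h2, h3⟩ := hc
    refine hω ⟨h1, ?_⟩
    simp only [h2, Option.getD_some]
    exact h3 0
  refine (measure_mono hsub).trans ((measure_union_le _ _).trans ?_)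
  rw [h0, add_zero]
  refine (measure_iUnion_fintype_le _ _).trans ?_
  rw [Nat.card_eq_fintype_card, ← Finset.card_univ, ← nsmul_eq_mul]
  refine Finset.sum_le_card_nsmul _ _ _ fun z _ => ?_
  have e : {ω | (T : ℕ∞) < A.codingRadius x ω z.1} =
      (fun (ω : Randomness d) h => ω (z.1 + h)) ⁻¹'
        {ω | (T : ℕ∞) < A.codingRadius (fun h => x (z.1 + h)) ω 0} := by
    ext ω
    simp only [Set.mem_ofPred_eq, Set.mem_preimage]
    rw [A.codingRadius_shift x ω z.1 0, add_zero]
  rw [e]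
  have hmp := measurePreserving_shift z.1
  refine (Measure.le_map_apply hmp.aemeasurable _).trans ?_
  rw [hmp.map_eq]
  exact le_iSup (fun x => iidLaw d {ω | (T : ℕ∞) < A.codingRadius x ω 0}) _

/-- Extends identifiers less than `N` on a ball to the whole grid. -/
noncomputable def extendIdent {W N : ℕ} (id : Ball d W → Fin N) : Grid d → ℕ :=
  glue (fun z => (id z : ℕ)) fun z => N + Encodable.encode z

theorem extendIdent_injective {W N : ℕ} {id : Ball d W → Fin N} (hid : Function.Injective id) :
    Function.Injective (extendIdent id) := by
  intro z z' h
  unfold extendIdent glue at h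
  split_ifs at h with h1 h2 h2 <;> dsimp only at h
  · exact congrArg Subtype.val (hid (Fin.ext h))
  · have := (id ⟨z, h1⟩).2
    omega
  · have := (id ⟨z', h2⟩).2
    omega
  · exact Encodable.encode_injective (by omega)

/-- The probabilistic method: some assignment of labels to identifiers works on all balls. -/
theorem exists_labels_of_identifiers [Finite I] [Nonempty I] {A : UniformAlgorithm d I O}
    {P : LCL d I O} (hA : A.Solves P) (T : ℕ) (o₀ : O) (i₀ : I) (N W : ℕ)
    (hlt : (((N * Nat.card I) ^ Nat.card (Ball d W) * Nat.card (Ball d P.radius) : ℕ) : ℝ≥0∞) *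
      A.tail T < 1) :
    ∃ φ : ℕ → unitInterval, ∀ id : Ball d W → Fin N, Function.Injective id →
      ∀ x : Ball d W → I,
        GoodAtOrigin A P T o₀ (glue x fun _ => i₀) fun z => φ (extendIdent id z) := by
  have := Fintype.ofFinite (Ball d W)
  have := Fintype.ofFinite I
  classical
  let μ : Measure (ℕ → unitInterval) := Measure.infinitePi fun _ => volume
  let J := {id : Ball d W → Fin N // Function.Injective id} × (Ball d W → I)
  let bad : J → Set (ℕ → unitInterval) := fun p =>
    {φ | ¬ GoodAtOrigin A P T o₀ (glue p.2 fun _ => i₀) fun z => φ (extendIdent p.1.1 z)}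
  have hbad : ∀ p, μ (bad p) ≤ Nat.card (Ball d P.radius) * A.tail T := by
    intro p
    refine le_trans ?_ (measure_not_goodAtOrigin_le hA T o₀ (glue p.2 fun _ => i₀))
    -- Because the extended identifiers are injective on the whole grid, the looked-up labels have
    -- exactly the law of iid labels.
    rw [iidLaw, ← map_infinitePi_comp_injective _ (extendIdent_injective p.1.2)]
    exact Measure.le_map_apply
      (measurable_pi_lambda _ fun z => measurable_pi_apply _).aemeasurable _
  have hunion : μ (⋃ p, bad p) < 1 := by
    refine lt_of_le_of_lt ?_ hlt
    refine (measure_iUnion_fintype_le _ _).trans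
      ((Finset.sum_le_card_nsmul _ _ _ fun p _ => hbad p).trans ?_)
    rw [nsmul_eq_mul, ← mul_assoc]
    gcongr
    rw [← Nat.cast_mul]
    refine Nat.cast_le.2 (Nat.mul_le_mul_right _ ?_)
    rw [Finset.card_univ, Fintype.card_prod, mul_pow]
    refine Nat.mul_le_mul ((Fintype.card_subtype_le _).trans ?_) ?_
    · simp
    · simp
  obtain ⟨φ, hφ⟩ : (⋃ p, bad p)ᶜ.Nonempty := by
    rw [Set.nonempty_compl]
    intro h
    rw [h, measure_univ] at hunion
    exact lt_irrefl _ hunion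
  refine ⟨φ, fun id hid x => ?_⟩
  by_contra h
  exact hφ (Set.mem_iUnion.2 ⟨(⟨id, hid⟩, x), h⟩)

theorem LCL.InULOCALLogStar.inLOCALLogStar (hd : 1 ≤ d) [Finite I] [Nonempty I] {P : LCL d I O}
    (h : P.InULOCALLogStar) {K : ℝ} (hK : 1 ≤ K) (a : ℕ) : P.InLOCALLogStar K a := by
  classical
  obtain ⟨A, hA, C, hC⟩ := (inULOCALLogStar_iff P).1 h
  let i₀ : I := Classical.arbitrary I
  obtain ⟨ω₀, c₀, -, -⟩ := (hA fun _ => i₀).exists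
  let o₀ : O := c₀ 0
  -- Since `n ≤ tower (log* n)`, two further levels give failure probability at most `2 ^ (-2 ^ n)`,
  -- which beats the number of configurations.
  let f : ℕ → ℕ := fun n => C * (logStar (n : ℝ) + 2)
  let W : ℕ → ℕ := fun n => f n + P.radius
  let good : ℕ → (ℕ → unitInterval) → Prop := fun n φ =>
    ∀ id : Ball d (W n) → Fin (n ^ a + 1), Function.Injective id → ∀ x : Ball d (W n) → I,
      GoodAtOrigin A P (f n) o₀ (glue x fun _ => i₀) fun z => φ (extendIdent id z)
  -- One choice of labels for each `n`, fixed before the torus is known; the zero default is only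
  -- met for small `n`.
  let φ : ℕ → ℕ → unitInterval := fun n => if h : ∃ φ, good n φ then h.choose else fun _ => 0
  have hφ : ∀ n, (∃ φ, good n φ) → good n (φ n) := fun n h => by
    simp only [φ, dif_pos h]
    exact h.choose_spec
  refine ⟨f, ?_, fun n ids x => (A.output (glue x fun _ => i₀)
    (glue (fun z => φ n (ids z)) fun _ => 0) 0).getD o₀, ?_⟩
  · refine IsBigO.of_bound (3 * C) ?_
    filter_upwards [tendsto_logStar.eventually_ge_atTop 1] with n hn
    simp only [Real.norm_natCast, f]
    have : C * (logStar (n : ℝ) + 2) ≤ 3 * C * logStar (n : ℝ) := by nlinarith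
    exact_mod_cast this
  · have h1 : Tendsto (fun n : ℕ => logStar (n : ℝ) + 2) atTop atTop :=
      tendsto_atTop_mono (fun _ => Nat.le_add_right _ _) tendsto_logStar
    filter_upwards [h1.eventually hC,
      eventually_config_lt a (Nat.card I) (Nat.card (Ball d P.radius)),
      eventually_logStar_add_le hd (K * (2 * C)) (K * (2 * (2 * C + P.radius) + 1)) (by positivity),
      eventually_ge_atTop 1] with n htail hconf hside hn1
    have hW : K * ((2 * W n + 1 : ℕ) : ℝ) ≤ (n : ℝ) ^ (1 / (d : ℝ)) := by
      refine le_trans (le_of_eq ?_) hside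
      simp only [W, f]
      push_cast
      ring
    have hW1 : ((2 * W n + 1 : ℕ) : ℝ) ≤ (n : ℝ) ^ (1 / (d : ℝ)) :=
      le_trans (le_mul_of_one_le_left (by positivity) hK) hW
    have hcard : Nat.card (Ball d (W n)) ≤ n := by
      refine (card_ball_le d (W n)).trans ?_
      have h2 := pow_le_pow_left₀ (by positivity) hW1 d
      rw [one_div, Real.rpow_inv_natCast_pow (by positivity) (by omega)] at h2
      exact_mod_cast h2
    have htower : 2 ^ 2 ^ n ≤ tower (logStar (n : ℝ) + 2) := by
      have h2 : n ≤ tower (logStar (n : ℝ)) := by exact_mod_cast le_tower_logStar (n : ℝ)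
      exact Nat.pow_le_pow_right (by norm_num) (Nat.pow_le_pow_right (by norm_num) h2)
    have hgood : good n (φ n) := by
      refine hφ n (exists_labels_of_identifiers hA (f n) o₀ i₀ _ _ ?_)
      have hI : 0 < Nat.card I := Nat.card_pos
      have h2 : ((n ^ a + 1) * Nat.card I) ^ Nat.card (Ball d (W n)) * Nat.card (Ball d P.radius) <
          tower (logStar (n : ℝ) + 2) := by
        refine lt_of_le_of_lt (Nat.mul_le_mul_right _ ?_) (hconf.trans_le htower)
        exact Nat.pow_le_pow_right (by positivity) hcard
      refine lt_of_le_of_lt (mul_le_mul_right htail _) ?_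
      rw [← div_eq_mul_inv]
      exact ENNReal.div_lt_of_lt_mul (by rw [one_mul]; exact_mod_cast h2)
    intro m hm ident hinj hident x v
    have hside : ∀ i, 2 * W n + 1 ≤ m i := fun i => by
      have h2 := (hW.trans (hm.2.2 i).2)
      have h3 := le_of_mul_le_mul_left h2 (by linarith)
      exact_mod_cast h3
    let id : Ball d (W n) → Fin (n ^ a + 1) := fun z =>
      ⟨ident (torusMove m v z.1), Nat.lt_succ_of_le (hident _).2⟩
    have hid : Function.Injective id := fun z z' e =>
      torusMove_injOn_ball hside v (hinj (Fin.mk.inj_iff.1 e))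
    obtain ⟨g1, g2⟩ := hgood id hid fun z => x (torusMove m v z.1)
    convert g2 using 1
    funext z
    have hzW : ∑ i, |z.1 i| ≤ (W n : ℤ) := z.2.trans (by simp only [W]; push_cast; omega)
    simp only [view, gridMove, zero_add]
    refine Prod.ext ?_ ?_ <;> dsimp only
    · exact (glue_apply_ball (fun z : Ball d (W n) => x (torusMove m v z.1)) _ ⟨z.1, hzW⟩).symm
    · refine congrArg (fun o : Option O => o.getD o₀) ?_
      -- The vertex at `z` sees only radius `f n` and pads the rest with defaults. Goodness bounds
      -- its coding radius by `f n`, so the padding is never read.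
      refine A.output_congr (g1 z) (fun y => ?_) (fun y => ?_)
      all_goals
        have hzy : ∑ i, |(z.1 + y.1) i| ≤ (W n : ℤ) := by
          have := sum_abs_add_le z.2 y.2
          rwa [add_comm P.radius] at this
        rw [zero_add, glue_apply_ball]
      · rw [glue_apply_ball _ _ (⟨z.1 + y.1, hzy⟩ : Ball d (W n)), torusMove_add]
        rfl
      · rw [extendIdent, glue_apply_ball _ _ (⟨z.1 + y.1, hzy⟩ : Ball d (W n))]
        simp only [id, torusMove_add]
        rfl

end Derandomisation

/-! ### Colour reduction in one round -/

/-- The lowest binary digit in which two numbers differ. -/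
noncomputable def firstDiff (a b : ℕ) : ℕ := sInf {i | a.testBit i ≠ b.testBit i}

theorem testBit_firstDiff_ne {a b : ℕ} (h : a ≠ b) :
    a.testBit (firstDiff a b) ≠ b.testBit (firstDiff a b) := by
  refine Nat.sInf_mem (s := {i | a.testBit i ≠ b.testBit i}) ?_
  by_contra hc
  rw [Set.not_nonempty_iff_eq_empty, Set.eq_empty_iff_forall_notMem] at hc
  exact h (Nat.eq_of_testBit_eq fun i => not_not.1 (hc i))

/-- The Cole–Vishkin step for numbers of unbounded length. -/
noncomputable def cvStep (a b : ℕ) : ℕ :=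
  if a.size = b.size then 3 * firstDiff a b + 1 + (a.testBit (firstDiff a b)).toNat
  else 3 * a.size

/-- Residues modulo `3` separate the cases: `0` means that the sizes differ, `1` and `2` carry the
digit. Two equal values of the first kind would give `a` and `b` equal size, against the choice of
case; two of the second kind would give them the same digit where they first differ. -/
theorem cvStep_ne {a b : ℕ} (hab : a ≠ b) (c : ℕ) : cvStep a b ≠ cvStep b c := by
  intro h
  unfold cvStep at h
  have h1 := Bool.toNat_lt (a.testBit (firstDiff a b))
  have h2 := Bool.toNat_lt (b.testBit (firstDiff b c))
  split_ifs at h with e1 e2 e2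
  · have e : firstDiff a b = firstDiff b c := by omega
    have h3 := testBit_firstDiff_ne hab
    rw [← e] at h
    have h4 : (a.testBit (firstDiff a b)).toNat = (b.testBit (firstDiff a b)).toNat := by omega
    revert h3 h4
    cases a.testBit (firstDiff a b) <;> cases b.testBit (firstDiff a b) <;> simp
  · omega
  · omega
  · omega

/-- The bound involves `a` alone, however long `b` is: digits are compared only when the sizes
agree, and then the first difference lies below that size. -/
theorem cvStep_le (a b : ℕ) : cvStep a b ≤ 3 * a.size + 2 := by
  unfold cvStep
  have h1 := Bool.toNat_lt (a.testBit (firstDiff a b))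
  split_ifs with e
  · rcases eq_or_ne a b with rfl | hab
    · have : firstDiff a a = 0 := by simp [firstDiff]
      omega
    · have h2 : firstDiff a b < a.size := by
        by_contra hc
        have h3 := testBit_firstDiff_ne hab
        have ha : a < 2 ^ firstDiff a b := Nat.size_le.1 (not_lt.1 hc)
        have hb : b < 2 ^ firstDiff a b := Nat.size_le.1 (e ▸ not_lt.1 hc)
        rw [Nat.testBit_lt_two_pow ha, Nat.testBit_lt_two_pow hb] at h3
        exact h3 rfl
      omega
  · omega

/-- One injection must serve tuples of all sizes, since no bound on the colours is known in advance.
Iterating `Nat.pair` squares the bound at each coordinate. -/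
theorem exists_polynomial_encoding (D : ℕ) : ∃ e : (Fin D → ℕ) → ℕ, Function.Injective e ∧
    ∀ x M, (∀ i, x i < M) → e x < (M + 1) ^ 2 ^ D := by
  induction D with
  | zero => exact ⟨fun _ => 0, fun _ _ _ => Subsingleton.elim _ _, fun x M _ => by simp⟩
  | succ D ih =>
    obtain ⟨e, he, hb⟩ := ih
    refine ⟨fun x => Nat.pair (x 0) (e (Fin.tail x)), fun x y h => ?_, fun x M hx => ?_⟩
    · obtain ⟨h1, h2⟩ := Nat.pair_eq_pair.1 h
      rw [← Fin.cons_self_tail x, ← Fin.cons_self_tail y, h1, he h2]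
    · refine (Nat.pair_lt_max_add_one_sq _ _).trans_le ?_
      have h1 := hb (Fin.tail x) M fun i => hx i.succ
      have h2 : M + 1 ≤ (M + 1) ^ 2 ^ D := Nat.le_self_pow (by positivity) _
      have h3 := hx 0
      rw [pow_succ 2 D, pow_mul]
      exact Nat.pow_le_pow_left (by omega) 2

/-- In one round, colours of `y` bits are replaced by colours of `O(log y)` bits, also when the
colours of the neighbours are longer. -/
theorem exists_colorReduction (ι : Type*) [Finite ι] :
    ∃ (Ψ : ℕ → (ι → ℕ) → ℕ) (E : ℕ), 1 ≤ E ∧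
      (∀ a x b y i, a ≠ x i → x i = b → Ψ a x ≠ Ψ b y) ∧
      ∀ a x y, a < 2 ^ y → Ψ a x < (3 * y + 4) ^ E := by
  obtain ⟨D, ⟨f⟩⟩ := Finite.exists_equiv_fin ι
  obtain ⟨e, he, hb⟩ := exists_polynomial_encoding D
  refine ⟨fun a x => e fun i => cvStep a (x (f.symm i)), 2 ^ D, Nat.one_le_two_pow, ?_, ?_⟩
  · rintro a x _ y i h1 rfl h
    have := congrFun (he h) (f i)
    simp only [Equiv.symm_apply_apply] at this
    exact cvStep_ne h1 _ this
  · intro a x y ha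
    refine hb _ (3 * y + 3) fun i => ?_
    have h1 := cvStep_le a (x (f.symm i))
    have h2 : a.size ≤ y := Nat.size_le.2 ha
    omega

/-- The bound on the colours from which `j` rounds of colour reduction lead to a constant number of
colours. -/
def threshold (E j : ℕ) : ℕ := 2 ^ (E * (2 * tower (E + j) + 4))

/-- With `X = 2 ^ tower (E + j)`, the claim is `3 * E * (2 * X + 4) + 4 ≤ 16 * X ^ 2` raised to the
power `E`. The offset `E` inside the tower is there to ensure `E ≤ X`. -/
theorem step_le_threshold (E j : ℕ) :
    (3 * (E * (2 * tower (E + (j + 1)) + 4)) + 4) ^ E ≤ threshold E j := by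
  have hE : E ≤ 2 ^ tower (E + j) :=
    ((lt_tower E).le.trans (tower_strictMono.monotone (Nat.le_add_right E j))).trans
      Nat.lt_two_pow_self.le
  have hX : 2 ≤ 2 ^ tower (E + j) := Nat.le_self_pow (tower_pos _).ne' 2
  have e : tower (E + (j + 1)) = 2 ^ tower (E + j) := rfl
  rw [threshold, mul_comm E (2 * tower (E + j) + 4), pow_mul, e]
  refine Nat.pow_le_pow_left ?_ E
  rw [pow_add, mul_comm 2 (tower (E + j)), pow_mul]
  generalize 2 ^ tower (E + j) = X at *
  nlinarith

/-! ### Iterated colour reduction and greedy colouring on the grid -/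

/-- The nonzero displacements of length at most `k`. -/
abbrev Nbr (d k : ℕ) : Type := {z : Grid d // z ≠ 0 ∧ ∑ i, |z i| ≤ (k : ℤ)}

instance (d k : ℕ) : Finite (Nbr d k) :=
  Finite.of_injective (β := Ball d k) (fun z => ⟨z.1, z.2.2⟩) fun _ _ h =>
    Subtype.ext (congrArg (fun z : Ball d k => z.1) h)

/-- The opposite displacement. -/
def Nbr.neg {d k : ℕ} (z : Nbr d k) : Nbr d k := ⟨-z.1, neg_ne_zero.2 z.2.1, by simpa using z.2.2⟩

section Deterministic

variable {d k : ℕ} (Ψ : ℕ → (Nbr d k → ℕ) → ℕ) (q : ℕ)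

/-- The colours after `j` rounds of colour reduction. -/
def iterColor (c : Grid d → ℕ) : ℕ → Grid d → ℕ
  | 0 => c
  | j + 1 => fun v => Ψ (iterColor c j v) fun z => iterColor c j (v + z.1)

/-- The first round after which the colour is less than `q`. -/
noncomputable def reductionTime (c : Grid d → ℕ) (v : Grid d) : ℕ :=
  sInf {j | iterColor Ψ c j v < q}

/-- The position of a vertex in the order in which the greedy algorithm colours the vertices. -/
noncomputable def rank (c : Grid d → ℕ) (v : Grid d) : ℕ :=
  q * reductionTime Ψ q c v + iterColor Ψ c (reductionTime Ψ q c v) v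

open Classical in
/-- The greedy colouring after all vertices of rank less than `n` have been coloured. -/
noncomputable def greedyStage (k : ℕ) (p : Grid d → ℕ) : ℕ → Grid d → ℕ
  | 0 => fun _ => 0
  | n + 1 => fun v => if p v = n then
      sInf {m | ∀ z : Nbr d k, p (v + z.1) < n → greedyStage k p n (v + z.1) ≠ m}
    else greedyStage k p n v

/-- The greedy colouring along the order given by `p`. -/
noncomputable def greedyColor (k : ℕ) (p : Grid d → ℕ) (v : Grid d) : ℕ :=
  greedyStage k p (p v + 1) v

theorem iterColor_ne (hΨ : ∀ a x b y i, a ≠ x i → x i = b → Ψ a x ≠ Ψ b y)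
    {c : Grid d → ℕ} (hc : ∀ v (z : Nbr d k), c v ≠ c (v + z.1)) (j : ℕ) (v : Grid d)
    (z : Nbr d k) : iterColor Ψ c j v ≠ iterColor Ψ c j (v + z.1) := by
  induction j generalizing v with
  | zero => exact hc v z
  | succ j ih => exact hΨ _ _ _ _ z (ih v) rfl

/-- Only the initial colour of `v` itself is assumed small: a round shrinks a colour regardless of
its neighbours. -/
theorem iterColor_lt {E : ℕ} (hΨ : ∀ a x y, a < 2 ^ y → Ψ a x < (3 * y + 4) ^ E)
    {c : Grid d → ℕ} {v : Grid d} {i j : ℕ} (h : c v < threshold E (i + j)) :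
    iterColor Ψ c j v < threshold E i := by
  induction j generalizing i with
  | zero => exact h
  | succ j ih =>
    have h1 := ih (i := i + 1) (by rwa [add_right_comm])
    exact (hΨ _ _ _ h1).trans_le (step_le_threshold E i)

theorem exists_lt_threshold {E : ℕ} (hE : 1 ≤ E) (n : ℕ) : ∃ j, n < threshold E j := by
  refine ⟨n, lt_of_lt_of_le (lt_tower n) (le_trans ?_ (Nat.lt_two_pow_self).le)⟩
  have := tower_strictMono.monotone (Nat.le_add_left n E)
  nlinarith

theorem reductionTime_le {E : ℕ} (hΨ : ∀ a x y, a < 2 ^ y → Ψ a x < (3 * y + 4) ^ E)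
    {c : Grid d → ℕ} {v : Grid d} {j : ℕ} (h : c v < threshold E j) :
    reductionTime Ψ (threshold E 0) c v ≤ j :=
  Nat.sInf_le (iterColor_lt Ψ hΨ (by rwa [zero_add]))

theorem iterColor_reductionTime_lt {E : ℕ} (hE : 1 ≤ E)
    (hΨ : ∀ a x y, a < 2 ^ y → Ψ a x < (3 * y + 4) ^ E) (c : Grid d → ℕ) (v : Grid d) :
    iterColor Ψ c (reductionTime Ψ (threshold E 0) c v) v < threshold E 0 := by
  obtain ⟨j, hj⟩ := exists_lt_threshold hE (c v)
  exact Nat.sInf_mem (s := {j | iterColor Ψ c j v < threshold E 0})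
    ⟨j, iterColor_lt Ψ hΨ (by rwa [zero_add])⟩

/-- As reduced colours are below `q`, the rank encodes the pair (time, colour). Equal ranks mean
equal times, and after equally many rounds neighbours still differ. -/
theorem rank_ne (hΨ : ∀ a x b y i, a ≠ x i → x i = b → Ψ a x ≠ Ψ b y)
    {c : Grid d → ℕ} (hq : ∀ v, iterColor Ψ c (reductionTime Ψ q c v) v < q)
    (hc : ∀ v (z : Nbr d k), c v ≠ c (v + z.1)) (v : Grid d) (z : Nbr d k) :
    rank Ψ q c v ≠ rank Ψ q c (v + z.1) := by
  intro h
  unfold rank at h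
  have h1 := congrArg (· / q) h
  have hq0 : 0 < q := lt_of_le_of_lt (Nat.zero_le _) (hq v)
  simp only [Nat.mul_add_div hq0, Nat.div_eq_of_lt (hq _), add_zero] at h1
  rw [← h1] at h
  exact iterColor_ne Ψ hΨ hc _ v z (Nat.add_left_cancel h)

theorem greedyStage_eq_greedyColor {p : Grid d → ℕ} {n : ℕ} {v : Grid d} (h : p v < n) :
    greedyStage k p n v = greedyColor k p v := by
  induction n with
  | zero => omega
  | succ n ih =>
    rcases Nat.lt_succ_iff_lt_or_eq.1 h with h1 | h1
    · rw [← ih h1]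
      exact if_neg h1.ne
    · rw [greedyColor, h1]

theorem greedyColor_eq (p : Grid d → ℕ) (v : Grid d) : greedyColor k p v =
    sInf {m | ∀ z : Nbr d k, p (v + z.1) < p v → greedyColor k p (v + z.1) ≠ m} := by
  refine (if_pos rfl).trans ?_
  congr 1
  ext m
  refine forall_congr' fun z => forall_congr' fun hz => ?_
  rw [greedyStage_eq_greedyColor hz]

theorem exists_free_color (p : Grid d → ℕ) (v : Grid d) : ∃ m ≤ Nat.card (Nbr d k),
    ∀ z : Nbr d k, p (v + z.1) < p v → greedyColor k p (v + z.1) ≠ m := by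
  classical
  have := Fintype.ofFinite (Nbr d k)
  let s : Finset ℕ := Finset.univ.image fun z : Nbr d k => greedyColor k p (v + z.1)
  have hs : s.card < (Finset.range (Nat.card (Nbr d k) + 1)).card := by
    rw [Finset.card_range, Nat.lt_succ_iff, Nat.card_eq_fintype_card]
    exact Finset.card_image_le
  obtain ⟨m, hm, hms⟩ := Finset.exists_mem_notMem_of_card_lt_card hs
  refine ⟨m, Nat.lt_succ_iff.1 (Finset.mem_range.1 hm), fun z _ h => hms ?_⟩
  exact Finset.mem_image.2 ⟨z, Finset.mem_univ _, h⟩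

theorem greedyColor_le (p : Grid d → ℕ) (v : Grid d) :
    greedyColor k p v ≤ Nat.card (Nbr d k) := by
  obtain ⟨m, hm, h⟩ := exists_free_color (k := k) p v
  rw [greedyColor_eq]
  exact le_trans (Nat.sInf_le (Set.mem_ofPred.2 h)) hm

theorem greedyColor_ne {p : Grid d → ℕ} (hp : ∀ v (z : Nbr d k), p v ≠ p (v + z.1)) (v : Grid d)
    (z : Nbr d k) : greedyColor k p v ≠ greedyColor k p (v + z.1) := by
  have key : ∀ v (z : Nbr d k), p (v + z.1) < p v →
      greedyColor k p v ≠ greedyColor k p (v + z.1) := by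
    intro v z hlt
    obtain ⟨m, -, h⟩ := exists_free_color (k := k) p v
    have h1 := Nat.sInf_mem
      (s := {m | ∀ z : Nbr d k, p (v + z.1) < p v → greedyColor k p (v + z.1) ≠ m}) ⟨m, h⟩
    rw [← greedyColor_eq] at h1
    exact (h1 z hlt).symm
  rcases lt_or_gt_of_ne (hp v z) with h | h
  · have e : v + z.1 + z.neg.1 = v := add_neg_cancel_right v z.1
    have := key (v + z.1) z.neg (by rwa [e])
    rw [e] at this
    exact this.symm
  · exact key v z h

/-! #### Equivariance -/

theorem iterColor_shift (c : Grid d → ℕ) (g : Grid d) (j : ℕ) (v : Grid d) :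
    iterColor Ψ (fun h => c (g + h)) j v = iterColor Ψ c j (g + v) := by
  induction j generalizing v with
  | zero => rfl
  | succ j ih => simp only [iterColor, ih, add_assoc]

theorem rank_shift (c : Grid d → ℕ) (g v : Grid d) :
    rank Ψ q (fun h => c (g + h)) v = rank Ψ q c (g + v) := by
  simp only [rank, reductionTime, iterColor_shift]

theorem greedyStage_shift (p : Grid d → ℕ) (g : Grid d) (n : ℕ) (v : Grid d) :
    greedyStage k (fun h => p (g + h)) n v = greedyStage k p n (g + v) := by
  induction n generalizing v with
  | zero => rfl
  | succ n ih => simp only [greedyStage, ih, add_assoc]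

theorem greedyColor_shift (p : Grid d → ℕ) (g v : Grid d) :
    greedyColor k (fun h => p (g + h)) v = greedyColor k p (g + v) := by
  simp only [greedyColor, greedyStage_shift]

/-! #### Locality -/

theorem iterColor_congr {c c' : Grid d → ℕ} {j : ℕ} {v : Grid d}
    (h : ∀ u : Grid d, ∑ i, |u i| ≤ ((k * j : ℕ) : ℤ) → c' (v + u) = c (v + u)) :
    iterColor Ψ c' j v = iterColor Ψ c j v := by
  induction j generalizing v with
  | zero => simpa [iterColor] using h 0 (by simp)
  | succ j ih =>
    have h1 : iterColor Ψ c' j v = iterColor Ψ c j v :=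
      ih fun u hu => h u (hu.trans (by gcongr; omega))
    have h2 : ∀ z : Nbr d k, iterColor Ψ c' j (v + z.1) = iterColor Ψ c j (v + z.1) := fun z =>
      ih fun u hu => by
        rw [add_assoc]
        exact h _ ((sum_abs_add_le z.2.2 hu).trans (le_of_eq (by push_cast; ring)))
    simp only [iterColor, h1, h2]

theorem rank_congr_of_lt {c c' : Grid d → ℕ} {n : ℕ} {v : Grid d}
    (hq : ∀ c v, iterColor Ψ c (reductionTime Ψ q c v) v < q)
    (h : ∀ u : Grid d, ∑ i, |u i| ≤ ((k * n : ℕ) : ℤ) → c' (v + u) = c (v + u))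
    (hn : rank Ψ q c v < n) : rank Ψ q c' v = rank Ψ q c v := by
  have hj : ∀ j ≤ n, iterColor Ψ c' j v = iterColor Ψ c j v := fun j hj =>
    iterColor_congr Ψ fun u hu => h u (hu.trans (by gcongr))
  have hq0 : 0 < q := lt_of_le_of_lt (Nat.zero_le _) (hq c v)
  have ht : reductionTime Ψ q c v ≤ n := by
    unfold rank at hn
    nlinarith
  have h1 : reductionTime Ψ q c' v ≤ reductionTime Ψ q c v :=
    Nat.sInf_le (by rw [Set.mem_ofPred_eq, hj _ ht]; exact hq c v)
  have h2 : reductionTime Ψ q c v ≤ reductionTime Ψ q c' v :=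
    Nat.sInf_le (by rw [Set.mem_ofPred_eq, ← hj _ (h1.trans ht)]; exact hq c' v)
  rw [rank, rank, le_antisymm h1 h2, hj _ ht]

/-- A neighbour may have huge rank, which no fixed ball determines. The ball of radius `k * n` does
determine the rank truncated at `n`, and stage `n` of the greedy colouring uses no more. -/
theorem min_rank_congr {c c' : Grid d → ℕ} {n : ℕ} {v : Grid d}
    (hq : ∀ c v, iterColor Ψ c (reductionTime Ψ q c v) v < q)
    (h : ∀ u : Grid d, ∑ i, |u i| ≤ ((k * n : ℕ) : ℤ) → c' (v + u) = c (v + u)) :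
    min (rank Ψ q c' v) n = min (rank Ψ q c v) n := by
  rcases lt_or_ge (rank Ψ q c v) n with h1 | h1
  · rw [rank_congr_of_lt Ψ q hq h h1]
  · rcases lt_or_ge (rank Ψ q c' v) n with h2 | h2
    · rw [rank_congr_of_lt Ψ q hq (fun u hu => (h u hu).symm) h2]
    · rw [min_eq_right h1, min_eq_right h2]

theorem greedyStage_congr {p p' : Grid d → ℕ} {n : ℕ} {v : Grid d}
    (h : ∀ u : Grid d, ∑ i, |u i| ≤ ((k * n : ℕ) : ℤ) → min (p' (v + u)) n = min (p (v + u)) n) :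
    greedyStage k p' n v = greedyStage k p n v := by
  induction n generalizing v with
  | zero => rfl
  | succ n ih =>
    have h0 : min (p' v) (n + 1) = min (p v) (n + 1) := by simpa using h 0 (by simp)
    have h1 : greedyStage k p' n v = greedyStage k p n v := ih fun u hu => by
      have := h u (hu.trans (by gcongr; omega))
      omega
    have h2 : ∀ z : Nbr d k, greedyStage k p' n (v + z.1) = greedyStage k p n (v + z.1) :=
      fun z => ih fun u hu => by
        have := h (z.1 + u) ((sum_abs_add_le z.2.2 hu).trans (le_of_eq (by push_cast; ring)))
        rw [add_assoc]
        omega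
    have h3 : ∀ z : Nbr d k, p' (v + z.1) < n ↔ p (v + z.1) < n := fun z => by
      have := h z.1 (z.2.2.trans (by push_cast; nlinarith))
      omega
    have h4 : p' v = n ↔ p v = n := by omega
    simp only [greedyStage, h1, h2, h3, h4]

theorem greedyColor_rank_congr {c c' : Grid d → ℕ} {n : ℕ} {v : Grid d}
    (hq : ∀ c v, iterColor Ψ c (reductionTime Ψ q c v) v < q) (hn : rank Ψ q c v < n)
    (h : ∀ u : Grid d, ∑ i, |u i| ≤ ((2 * k * n : ℕ) : ℤ) → c' (v + u) = c (v + u)) :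
    greedyColor k (rank Ψ q c') v = greedyColor k (rank Ψ q c) v := by
  have h1 : rank Ψ q c' v = rank Ψ q c v := rank_congr_of_lt Ψ q hq
    (fun u hu => h u (hu.trans (by push_cast; nlinarith))) hn
  rw [← greedyStage_eq_greedyColor hn, ← greedyStage_eq_greedyColor (h1.trans_lt hn)]
  -- The radius `2 * k * n` splits into `k * n` for the greedy stages and `k * n` for the truncated
  -- ranks they consult.
  refine greedyStage_congr fun u hu => min_rank_congr Ψ q hq fun u' hu' => ?_
  rw [add_assoc]
  exact h _ ((sum_abs_add_le hu hu').trans (le_of_eq (by push_cast; ring)))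

end Deterministic

/-! ### Separation by binary digits -/

/-- The integer formed by the first `i` binary digits. -/
noncomputable def digits (i : ℕ) (x : unitInterval) : ℕ := ⌊(2 : ℝ) ^ i * x⌋₊

theorem measurable_digits (i : ℕ) : Measurable (digits i) :=
  Nat.measurable_floor.comp (measurable_subtype_coe.const_mul _)

theorem digits_le (i : ℕ) (x : unitInterval) : digits i x ≤ 2 ^ i := by
  refine Nat.floor_le_of_le ?_
  have := x.2.2
  push_cast
  exact mul_le_of_le_one_right (by positivity) this

theorem volume_digits_eq_le (i a : ℕ) :
    volume {x : unitInterval | digits i x = a} ≤ ((2 : ℝ≥0∞) ^ i)⁻¹ := by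
  have hpos : (0 : ℝ) < 2 ^ i := by positivity
  have hsub : Subtype.val '' {x : unitInterval | digits i x = a} ⊆
      Set.Icc ((a : ℝ) / 2 ^ i) ((a + 1) / 2 ^ i) := by
    rintro _ ⟨x, hx, rfl⟩
    have h0 : 0 ≤ (2 : ℝ) ^ i * x := mul_nonneg hpos.le x.2.1
    have h1 := (Nat.floor_eq_iff h0).1 hx
    rw [Set.mem_Icc, div_le_iff₀ hpos, le_div_iff₀ hpos]
    constructor <;> nlinarith [h1.1, h1.2]
  rw [Measure.Subtype.volume_def, comap_subtype_coe_apply measurableSet_Icc]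
  refine (measure_mono hsub).trans ?_
  rw [Real.volume_Icc, ← sub_div, add_sub_cancel_left, one_div, ENNReal.ofReal_inv_of_pos hpos,
    ENNReal.ofReal_pow (by norm_num)]
  simp

/-- Sum over the common value: by independence each has probability at most `2 ^ (-2 * i)`. There
are `2 ^ i + 1` values, the last one arising from the label `1`. -/
theorem measure_digits_eq_le {d : ℕ} (i : ℕ) {u v : Grid d} (h : u ≠ v) :
    iidLaw d {ω | digits i (ω u) = digits i (ω v)} ≤ 2 * ((2 : ℝ≥0∞) ^ i)⁻¹ := by
  classical
  have hsub : {ω : Randomness d | digits i (ω u) = digits i (ω v)} ⊆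
      ⋃ a ∈ Finset.range (2 ^ i + 1),
        Set.pi (({u, v} : Finset (Grid d)) : Set (Grid d)) fun _ => {x | digits i x = a} := by
    intro ω hω
    simp only [Set.mem_iUnion, Finset.mem_range, exists_prop]
    refine ⟨digits i (ω u), Nat.lt_succ_of_le (digits_le _ _), fun w hw => ?_⟩
    simp only [Finset.coe_insert, Finset.coe_singleton, Set.mem_insert_iff,
      Set.mem_singleton_iff] at hw
    rcases hw with rfl | rfl
    · rfl
    · exact hω.symm
  refine (measure_mono hsub).trans ((measure_biUnion_finset_le _ _).trans ?_)
  have hbox : ∀ a ∈ Finset.range (2 ^ i + 1),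
      iidLaw d (Set.pi (({u, v} : Finset (Grid d)) : Set (Grid d)) fun _ => digits i ⁻¹' {a}) ≤
        ((2 : ℝ≥0∞) ^ i)⁻¹ * ((2 : ℝ≥0∞) ^ i)⁻¹ := by
    intro a _
    rw [iidLaw, Measure.infinitePi_pi _ fun _ _ => measurable_digits i (measurableSet_singleton a),
      Finset.prod_pair h]
    exact mul_le_mul' (volume_digits_eq_le i a) (volume_digits_eq_le i a)
  refine (Finset.sum_le_card_nsmul _ _ _ hbox).trans ?_
  rw [Finset.card_range, nsmul_eq_mul, ← mul_assoc]
  gcongr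
  calc ((2 ^ i + 1 : ℕ) : ℝ≥0∞) * ((2 : ℝ≥0∞) ^ i)⁻¹
      ≤ (2 * 2 ^ i) * ((2 : ℝ≥0∞) ^ i)⁻¹ := by
        gcongr
        have : 2 ^ i + 1 ≤ 2 * 2 ^ i := by have := Nat.one_le_two_pow (n := i); omega
        exact_mod_cast this
    _ = 2 := by
        rw [mul_assoc, ENNReal.mul_inv_cancel (by positivity) (by finiteness), mul_one]

theorem measurable_sInf_nat {Ω : Type*} [MeasurableSpace Ω] {p : ℕ → Ω → Prop}
    (hp : ∀ n, MeasurableSet {ω | p n ω}) : Measurable fun ω => sInf {n | p n ω} := by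
  refine measurable_to_countable' fun n => ?_
  have hlt : MeasurableSet {ω | ∀ m < n, ¬ p m ω} := by
    have : {ω | ∀ m < n, ¬ p m ω} = ⋂ m, ⋂ (_ : m < n), {ω | p m ω}ᶜ := by ext; simp
    rw [this]
    exact MeasurableSet.iInter fun m => MeasurableSet.iInter fun _ => (hp m).compl
  have hnone : MeasurableSet {ω | n = 0 ∧ ∀ m, ¬ p m ω} := by
    have : {ω | n = 0 ∧ ∀ m, ¬ p m ω} = {_ω : Ω | n = 0} ∩ ⋂ m, {ω | p m ω}ᶜ := by ext; simp
    rw [this]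
    exact (MeasurableSet.const _).inter (MeasurableSet.iInter fun m => (hp m).compl)
  have e : (fun ω => sInf {n | p n ω}) ⁻¹' {n} =
      ({ω | p n ω} ∩ {ω | ∀ m < n, ¬ p m ω}) ∪ {ω | n = 0 ∧ ∀ m, ¬ p m ω} := by
    ext ω
    simp only [Set.mem_preimage, Set.mem_singleton_iff, Set.mem_union, Set.mem_inter_iff,
      Set.mem_ofPred_eq]
    constructor
    · rintro rfl
      by_cases hne : ∃ m, p m ω
      · exact Or.inl ⟨Nat.sInf_mem hne, fun m hm h => Nat.notMem_of_lt_sInf hm h⟩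
      · have he : {n | p n ω} = ∅ := Set.eq_empty_of_forall_notMem fun m hm => hne ⟨m, hm⟩
        exact Or.inr ⟨by rw [he, Nat.sInf_empty], fun m hm => hne ⟨m, hm⟩⟩
    · rintro (⟨h1, h2⟩ | ⟨rfl, h2⟩)
      · refine le_antisymm (Nat.sInf_le h1) ?_
        by_contra hc
        exact h2 _ (not_le.1 hc) (Nat.sInf_mem (s := {n | p n ω}) ⟨n, h1⟩)
      · have he : {n | p n ω} = ∅ := Set.eq_empty_of_forall_notMem h2
        rw [he, Nat.sInf_empty]
  rw [e]
  exact ((hp n).inter hlt).union hnone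

/-! ### A random colouring by natural numbers -/

section BaseColor

variable {d : ℕ} (k : ℕ)

/-- The first `i` digits of the label of `v` differ from those of all its neighbours. -/
def Separated (ω : Randomness d) (v : Grid d) (i : ℕ) : Prop :=
  ∀ z : Nbr d k, digits i (ω v) ≠ digits i (ω (v + z.1))

/-- The number of digits which are needed to tell the label of `v` from those of its neighbours. -/
noncomputable def separationLevel (ω : Randomness d) (v : Grid d) : ℕ :=
  sInf {i | Separated k ω v i}

/-- The shortest initial piece of the label of `v` which differs from those of its neighbours. -/
noncomputable def baseColor (ω : Randomness d) (v : Grid d) : ℕ :=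
  Nat.pair (separationLevel k ω v) (digits (separationLevel k ω v) (ω v))

variable {k}

theorem baseColor_lt {ω : Randomness d} {v : Grid d} {i : ℕ} (h : Separated k ω v i) :
    baseColor k ω v < 2 ^ (2 * i + 2) := by
  have h1 : separationLevel k ω v ≤ i := Nat.sInf_le h
  have h2 : separationLevel k ω v ≤ 2 ^ i := h1.trans (Nat.lt_two_pow_self).le
  have h3 := (digits_le (separationLevel k ω v) (ω v)).trans
    (Nat.pow_le_pow_right (by norm_num) h1)
  refine (Nat.pair_lt_max_add_one_sq _ _).trans_le ?_
  have h4 : 1 ≤ 2 ^ i := Nat.one_le_two_pow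
  have e : 2 ^ (2 * i + 2) = (2 ^ (i + 1)) ^ 2 := by rw [← pow_mul]; congr 1; ring
  rw [e, pow_succ 2 i]
  exact Nat.pow_le_pow_left (by omega) 2

/-- Since the level is part of the colour, equal colours would compare equally many digits, and at
its own level `v` is separated. -/
theorem baseColor_ne {ω : Randomness d} {v : Grid d} (h : ∃ i, Separated k ω v i) (z : Nbr d k) :
    baseColor k ω v ≠ baseColor k ω (v + z.1) := by
  intro e
  obtain ⟨e1, e2⟩ := Nat.pair_eq_pair.1 e
  rw [← e1] at e2
  exact Nat.sInf_mem (s := {i | Separated k ω v i}) h z e2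

theorem measure_not_separated_le (v : Grid d) (i : ℕ) :
    iidLaw d {ω | ¬ Separated k ω v i} ≤ (2 * Nat.card (Nbr d k) : ℕ) * ((2 : ℝ≥0∞) ^ i)⁻¹ := by
  have := Fintype.ofFinite (Nbr d k)
  have e : {ω | ¬ Separated k ω v i} =
      ⋃ z : Nbr d k, {ω | digits i (ω v) = digits i (ω (v + z.1))} := by
    ext ω
    simp only [Separated, Set.mem_ofPred_eq, Set.mem_iUnion, ne_eq, not_forall, not_not]
  rw [e]
  refine (measure_iUnion_fintype_le _ _).trans ((Finset.sum_le_card_nsmul _ _ _ fun z _ =>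
    measure_digits_eq_le i fun h => z.2.1 (left_eq_add.1 h)).trans (le_of_eq ?_))
  rw [nsmul_eq_mul, Finset.card_univ, Nat.card_eq_fintype_card]
  push_cast
  ring

theorem ae_exists_separated :
    ∀ᵐ ω ∂(iidLaw d), ∀ v, ∃ i, Separated k ω v i := by
  rw [ae_all_iff]
  intro v
  have hle : ∀ i : ℕ, iidLaw d {ω | ¬ ∃ i, Separated k ω v i} ≤
      (2 * Nat.card (Nbr d k) : ℕ) * ((2 : ℝ≥0∞)⁻¹) ^ i := fun i => by
    rw [← ENNReal.inv_pow]
    exact (measure_mono fun ω (hω : ¬ ∃ i, Separated k ω v i) => not_exists.1 hω i).trans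
      (measure_not_separated_le v i)
  have hlim : Tendsto (fun i : ℕ => ((2 * Nat.card (Nbr d k) : ℕ) : ℝ≥0∞) * ((2 : ℝ≥0∞)⁻¹) ^ i)
      atTop (𝓝 0) := by
    have := ENNReal.Tendsto.const_mul (a := ((2 * Nat.card (Nbr d k) : ℕ) : ℝ≥0∞))
      (ENNReal.tendsto_pow_atTop_nhds_zero_of_lt_one (r := (2 : ℝ≥0∞)⁻¹) (by norm_num))
      (Or.inr (by finiteness))
    rwa [mul_zero] at this
  exact le_antisymm (ge_of_tendsto' hlim hle) bot_le

theorem separated_shift (ω : Randomness d) (g v : Grid d) (i : ℕ) :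
    Separated k (fun h => ω (g + h)) v i ↔ Separated k ω (g + v) i := by
  simp only [Separated, add_assoc]

theorem baseColor_shift (ω : Randomness d) (g v : Grid d) :
    baseColor k (fun h => ω (g + h)) v = baseColor k ω (g + v) := by
  simp only [baseColor, separationLevel, separated_shift]

theorem baseColor_congr {ω ω' : Randomness d} {v : Grid d}
    (h : ∀ u : Grid d, ∑ i, |u i| ≤ (k : ℤ) → ω' (v + u) = ω (v + u)) :
    baseColor k ω' v = baseColor k ω v := by
  have h0 : ω' v = ω v := by simpa using h 0 (by simp)
  have h1 : ∀ i, Separated k ω' v i ↔ Separated k ω v i := fun i =>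
    forall_congr' fun z => by rw [h0, h z.1 z.2.2]
  simp only [baseColor, separationLevel, h1, h0]

theorem measurable_baseColor (v : Grid d) : Measurable fun ω => baseColor k ω v := by
  have hdig : ∀ i u, Measurable fun ω : Randomness d => digits i (ω u) := fun i u =>
    (measurable_digits i).comp (measurable_pi_apply u)
  have hsep : ∀ i, MeasurableSet {ω | Separated k ω v i} := fun i => by
    have : {ω | Separated k ω v i} =
        ⋂ z : Nbr d k, {ω | digits i (ω v) = digits i (ω (v + z.1))}ᶜ := by
      ext ω
      simp only [Separated, Set.mem_ofPred_eq, Set.mem_iInter, Set.mem_compl_iff, ne_eq]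
    rw [this]
    exact MeasurableSet.iInter fun z => (measurableSet_eq_fun (hdig i _) (hdig i _)).compl
  have hlev : Measurable fun ω => separationLevel k ω v := measurable_sInf_nat hsep
  have hpair : Measurable fun p : ℕ × Randomness d => Nat.pair p.1 (digits p.1 (p.2 v)) :=
    measurable_from_prod_countable_right fun i =>
      (measurable_of_countable fun m => Nat.pair i m).comp (hdig i v)
  exact hpair.comp (hlev.prodMk measurable_id)

end BaseColor

/-! ### Measurability of colour reduction -/

section Measurability

variable {d k : ℕ} {Ω : Type*} [MeasurableSpace Ω]

theorem measurable_iterColor (Ψ : ℕ → (Nbr d k → ℕ) → ℕ) {c : Ω → Grid d → ℕ}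
    (hc : ∀ v, Measurable fun ω => c ω v) (j : ℕ) (v : Grid d) :
    Measurable fun ω => iterColor Ψ (c ω) j v := by
  induction j generalizing v with
  | zero => exact hc v
  | succ j ih =>
    have hΨ : Measurable fun p : ℕ × (Nbr d k → ℕ) => Ψ p.1 p.2 := measurable_of_countable _
    exact hΨ.comp ((ih v).prodMk (measurable_pi_lambda _ fun z => ih (v + z.1)))

theorem measurable_rank (Ψ : ℕ → (Nbr d k → ℕ) → ℕ) (q : ℕ) {c : Ω → Grid d → ℕ}
    (hc : ∀ v, Measurable fun ω => c ω v) (v : Grid d) :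
    Measurable fun ω => rank Ψ q (c ω) v := by
  have ht : Measurable fun ω => reductionTime Ψ q (c ω) v :=
    measurable_sInf_nat fun j => measurable_iterColor Ψ hc j v measurableSet_Iio
  have hp : Measurable fun p : ℕ × Ω => q * p.1 + iterColor Ψ (c p.2) p.1 v :=
    measurable_from_prod_countable_right fun j => (measurable_iterColor Ψ hc j v).const_add (q * j)
  exact hp.comp (ht.prodMk measurable_id)

theorem measurable_greedyStage {p : Ω → Grid d → ℕ} (hp : ∀ v, Measurable fun ω => p ω v) (n : ℕ)
    (v : Grid d) : Measurable fun ω => greedyStage k (p ω) n v := by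
  classical
  induction n generalizing v with
  | zero => exact measurable_const
  | succ n ih =>
    have hf : Measurable fun x : (ℕ × ℕ) × (Nbr d k → ℕ × ℕ) => if x.1.1 = n then
        sInf {m | ∀ z, (x.2 z).1 < n → (x.2 z).2 ≠ m} else x.1.2 := measurable_of_countable _
    have := hf.comp (((hp v).prodMk (ih v)).prodMk
      (measurable_pi_lambda (fun ω (z : Nbr d k) =>
        (p ω (v + z.1), greedyStage k (p ω) n (v + z.1))) fun z => (hp _).prodMk (ih _)))
    simp only [greedyStage]
    exact this

theorem measurable_greedyColor {p : Ω → Grid d → ℕ} (hp : ∀ v, Measurable fun ω => p ω v)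
    (v : Grid d) : Measurable fun ω => greedyColor k (p ω) v := by
  have h : Measurable fun x : ℕ × Ω => greedyStage k (p x.2) (x.1 + 1) v :=
    measurable_from_prod_countable_right fun n => measurable_greedyStage hp (n + 1) v
  exact h.comp ((hp v).prodMk measurable_id)

end Measurability

/-- Distance colourings of the grid as finitary factors of iid with tower-function tail decay. -/
theorem exists_distance_coloring (d k : ℕ) : ∃ col : Randomness d → Grid d → ℕ,
    (∀ v, Measurable fun ω => col ω v) ∧
    (∀ ω g v, col (fun h => ω (g + h)) v = col ω (g + v)) ∧
    (∀ ω v, col ω v ≤ Nat.card (Nbr d k)) ∧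
    (∀ᵐ ω ∂(iidLaw d), ∀ v (z : Nbr d k), col ω v ≠ col ω (v + z.1)) ∧
    ∃ C N : ℕ, ∀ j v, iidLaw d {ω | ¬ ∀ ω' : Randomness d,
      (∀ u : Grid d, ∑ i, |u i| ≤ ((C * (j + 1) : ℕ) : ℤ) → ω' (v + u) = ω (v + u)) →
        col ω' v = col ω v} ≤ N * ((tower (j + 1) : ℕ) : ℝ≥0∞)⁻¹ := by
  obtain ⟨Ψ, E, hE, hne, hlt⟩ := exists_colorReduction (Nbr d k)
  have hq : ∀ (c : Grid d → ℕ) v,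
      iterColor Ψ c (reductionTime Ψ (threshold E 0) c v) v < threshold E 0 :=
    iterColor_reductionTime_lt Ψ hE hlt
  refine ⟨fun ω => greedyColor k (rank Ψ (threshold E 0) (baseColor k ω)), fun v => ?_,
    -- The summand `2 * k * threshold E 0` pays for ranks up to `threshold E 0 * (j + 1)`, and `k`
    -- for reading the base colours.
    fun ω g v => ?_, fun ω v => greedyColor_le _ _, ?_, 2 * k * threshold E 0 + k,
    2 * Nat.card (Nbr d k), fun j v => ?_⟩
  · exact measurable_greedyColor (measurable_rank Ψ _ measurable_baseColor) v
  · refine Eq.trans ?_ (greedyColor_shift _ g v)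
    dsimp only
    congr 1
    funext h
    rw [← rank_shift]
    congr 1
    funext u
    exact baseColor_shift ω g u
  · filter_upwards [ae_exists_separated (k := k)] with ω hω v z
    exact greedyColor_ne (rank_ne Ψ _ hne (hq _) fun v z => baseColor_ne (hω v) z) v z
  · have hsub : {ω : Randomness d | ¬ ∀ ω' : Randomness d,
        (∀ u : Grid d, ∑ i, |u i| ≤ (((2 * k * threshold E 0 + k) * (j + 1) : ℕ) : ℤ) →
          ω' (v + u) = ω (v + u)) →
        greedyColor k (rank Ψ (threshold E 0) (baseColor k ω')) v =
          greedyColor k (rank Ψ (threshold E 0) (baseColor k ω)) v} ⊆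
        {ω | ¬ Separated k ω v (tower (E + j))} := by
      intro ω hω hsep
      refine hω fun ω' hω' => ?_
      have h1 : baseColor k ω v < threshold E j := by
        refine (baseColor_lt hsep).trans_le (Nat.pow_le_pow_right (by norm_num) ?_)
        nlinarith
      -- The reduction time is at most `j` and the reduced colour is below `threshold E 0`.
      have h2 : rank Ψ (threshold E 0) (baseColor k ω) v < threshold E 0 * (j + 1) := by
        have h3 := reductionTime_le Ψ hlt h1
        have h4 := hq (baseColor k ω) v
        unfold rank
        nlinarith
      refine greedyColor_rank_congr Ψ _ hq h2 fun u hu => baseColor_congr fun u' hu' => ?_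
      rw [add_assoc]
      refine hω' _ ((sum_abs_add_le hu hu').trans ?_)
      push_cast
      nlinarith
    refine (measure_mono hsub).trans ((measure_not_separated_le v _).trans ?_)
    gcongr
    have h5 : tower j ≤ tower (E + j) := tower_strictMono.monotone (Nat.le_add_left j E)
    have h6 : tower (j + 1) ≤ 2 ^ tower (E + j) := Nat.pow_le_pow_right (by norm_num) h5
    exact_mod_cast h6

/-! ### From local algorithms to uniform algorithms -/

section LocalToUniform

variable {d : ℕ} {I O : Type*}

theorem ae_factorRadius_lt_top {F : Randomness d → Grid d → O}
    (h : HasTowerDecay fun r => iidLaw d {ω | (r : ℕ∞) < factorRadius F ω}) :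
    ∀ᵐ ω ∂(iidLaw d), factorRadius F ω < ⊤ := by
  obtain ⟨C, hC⟩ := h
  have hlim : Tendsto (fun j => ((tower j : ℕ) : ℝ≥0∞)⁻¹) atTop (𝓝 0) :=
    ENNReal.tendsto_inv_nat_nhds_zero.comp tower_strictMono.tendsto_atTop
  refine le_antisymm (ge_of_tendsto hlim (hC.mono fun j hj => (measure_mono ?_).trans hj)) bot_le
  intro ω hω
  have htop : factorRadius F ω = ⊤ := not_lt_top_iff.1 hω
  simp only [Set.mem_ofPred_eq, htop]
  exact ENat.natCast_lt_top _

/-- The view of a finitary factor with tower-function tail decay in a ball is again such a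
factor. -/
theorem hasTowerDecay_view {S : Type*} {col : Randomness d → Grid d → S} {C N : ℕ}
    (hcol : ∀ j v, iidLaw d {ω | ¬ ∀ ω' : Randomness d,
      (∀ u : Grid d, ∑ i, |u i| ≤ ((C * (j + 1) : ℕ) : ℤ) → ω' (v + u) = ω (v + u)) →
        col ω' v = col ω v} ≤ N * ((tower (j + 1) : ℕ) : ℝ≥0∞)⁻¹) (r : ℕ) :
    HasTowerDecay fun R => iidLaw d
      {ω | (R : ℕ∞) < factorRadius (fun ω v => view gridMove (col ω) v r) ω} := by
  have := Fintype.ofFinite (Ball d r)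
  refine ⟨2 * C + r, ?_⟩
  -- Passing from `tower (j + 1)` to `tower j` gains a factor of at least `tower j`, which absorbs
  -- the constant of the union bound.
  have hbig : ∀ᶠ j in atTop, Nat.card (Ball d r) * N ≤ tower j ∧ tower j ^ 2 < 2 ^ tower j :=
    (tower_strictMono.tendsto_atTop.eventually_ge_atTop _).and
      (tower_strictMono.tendsto_atTop.eventually (eventually_pow_lt_two_pow 2))
  filter_upwards [hbig, eventually_ge_atTop 1] with j hj hj1
  have hsub : {ω | (((2 * C + r) * j : ℕ) : ℕ∞) <
      factorRadius (fun ω v => view gridMove (col ω) v r) ω} ⊆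
      ⋃ z : Ball d r, {ω | ¬ ∀ ω' : Randomness d,
        (∀ u : Grid d, ∑ i, |u i| ≤ ((C * (j + 1) : ℕ) : ℤ) → ω' (z.1 + u) = ω (z.1 + u)) →
          col ω' z.1 = col ω z.1} := by
    intro ω hω
    by_contra hc
    simp only [Set.mem_iUnion, Set.mem_ofPred_eq, not_exists, not_not] at hc
    refine (Set.mem_ofPred.1 hω).not_ge (factorRadius_le_iff.2 fun ω' hω' => funext fun z => ?_)
    simp only [view, gridMove, zero_add]
    refine hc z ω' fun u hu => hω' ⟨z.1 + u, (sum_abs_add_le z.2 hu).trans ?_⟩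
    have : r + C * (j + 1) ≤ (2 * C + r) * j := by nlinarith
    exact_mod_cast this
  refine (measure_mono hsub).trans ((measure_iUnion_fintype_le _ _).trans
    ((Finset.sum_le_card_nsmul _ _ _ fun z _ => hcol j z.1).trans ?_))
  rw [nsmul_eq_mul, Finset.card_univ, ← Nat.card_eq_fintype_card, ← mul_assoc, ← Nat.cast_mul,
    ← div_eq_mul_inv]
  have hpos : ((tower j : ℕ) : ℝ≥0∞) ≠ 0 := by exact_mod_cast (tower_pos j).ne'
  rw [ENNReal.div_le_iff (by exact_mod_cast (tower_pos (j + 1)).ne') (by finiteness),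
    mul_comm (_⁻¹), ← div_eq_mul_inv,
    ENNReal.le_div_iff_mul_le (Or.inl hpos) (Or.inl (by finiteness))]
  have h1 : Nat.card (Ball d r) * N * tower j ≤ tower (j + 1) := by
    have h2 : tower j * tower j < tower (j + 1) := by rw [← sq]; exact hj.2
    nlinarith [hj.1]
  exact_mod_cast h1

/-- Distinct identifiers less than `n` on a ball extend to identifiers of a torus with `n`
vertices. -/
theorem exists_torus_identifiers {W n : ℕ} {m : Fin d → ℕ} (hm : ∀ i, 2 * W + 1 ≤ m i)
    (hn : ∏ i, m i = n) {lab : Ball d W → ℕ} (hlab : Function.Injective lab)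
    (hlt : ∀ z, lab z < n) :
    ∃ ident : Torus m → ℕ, Function.Injective ident ∧ (∀ u, ident u < n) ∧
      ∀ z : Ball d W, ident (torusMove m 0 z.1) = lab z := by
  have hne : ∀ i, NeZero (m i) := fun i => ⟨by have := hm i; omega⟩
  have hemb := torusMove_injOn_ball hm 0
  have hcard : Fintype.card (Torus m) = (Finset.range n).card := by
    rw [Finset.card_range, ← hn, Fintype.card_pi]
    simp
  obtain ⟨e, he⟩ := Set.MapsTo.exists_equiv_extend_of_card_eq hcard
    (s := Set.range fun z : Ball d W => torusMove m 0 z.1)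
    (f := Function.extend (fun z : Ball d W => torusMove m 0 z.1) lab 0)
    (by
      rintro _ ⟨z, rfl⟩
      rw [hemb.extend_apply]
      exact Finset.mem_coe.2 (Finset.mem_range.2 (hlt z)))
    (by
      rintro _ ⟨z, rfl⟩ _ ⟨z', rfl⟩ h
      rw [hemb.extend_apply, hemb.extend_apply] at h
      rw [hlab h])
  refine ⟨fun u => e u, Subtype.val_injective.comp e.injective,
    fun u => Finset.mem_range.1 (e u).2, fun z => ?_⟩
  exact (he _ ⟨z, rfl⟩).trans (hemb.extend_apply _ _ z)

/-- A local algorithm which is correct on a torus of some size also works on the grid, with a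
distance colouring in place of the identifiers. -/
theorem isColoring_of_distance_coloring {P : LCL d I O} {f : ℕ → ℕ} {A : LocalAlgorithm d I O f}
    {n a : ℕ} (ha : 1 ≤ a) {m : Fin d → ℕ} (hm : ∀ i, 2 * (f n + P.radius) + 1 ≤ m i)
    (hn : ∏ i, m i = n)
    (hA : ∀ ident : Torus m → ℕ, Function.Injective ident → (∀ v, 1 ≤ ident v ∧ ident v ≤ n ^ a) →
      ∀ x : Torus m → I, P.IsColoring (torusMove m) x (A.run n m ident x))
    {col : Grid d → ℕ} (hlt : ∀ v, col v < n)
    (hcol : ∀ v (z : Nbr d (2 * (f n + P.radius))), col v ≠ col (v + z.1)) (x : Grid d → I) :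
    P.IsColoring gridMove x fun v =>
      A n (fun z => view gridMove col v (f n) z + 1) (view gridMove x v (f n)) := by
  intro v
  have hemb := torusMove_injOn_ball hm 0
  -- Two points of this ball differ by at most twice its radius, the distance up to which `col` is
  -- proper.
  have hlab : Function.Injective fun z : Ball d (f n + P.radius) => col (v + z.1) := by
    intro z z' h
    by_contra hne
    have h1 : ∑ i, |(z'.1 + -z.1) i| ≤ ((2 * (f n + P.radius) : ℕ) : ℤ) :=
      (sum_abs_add_le z'.2 (by simpa only [Pi.neg_apply, abs_neg] using z.2)).trans
        (le_of_eq (by push_cast; ring))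
    have h2 := hcol (v + z.1) ⟨z'.1 + -z.1, fun h0 => hne (Subtype.ext
      (add_neg_eq_zero.1 h0).symm), h1⟩
    refine h2 (h.trans (congrArg col (funext fun i => ?_)))
    simp only [Pi.add_apply, Pi.neg_apply]
    ring
  obtain ⟨ident, hinj, hident, hext⟩ := exists_torus_identifiers hm hn hlab fun z => hlt _
  let x' : Torus m → I := Function.extend
    (fun z : Ball d (f n + P.radius) => torusMove m 0 z.1) (fun z => x (v + z.1)) fun _ => x 0
  have hx' : ∀ z : Ball d (f n + P.radius), x' (torusMove m 0 z.1) = x (v + z.1) := fun z =>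
    hemb.extend_apply (fun z => x (v + z.1)) (fun _ => x 0) z
  -- Colours start at `0` and identifiers at `1`. The torus labelling depends on `v`, and only its
  -- correctness at the vertex `0` is used.
  have hgood := hA (fun u => ident u + 1) (fun u u' h => hinj (Nat.succ_injective h))
    (fun u => ⟨Nat.le_add_left _ _, (Nat.succ_le_of_lt (hident u)).trans
      (Nat.le_self_pow (by omega) n)⟩) x' 0
  convert hgood using 1
  funext z
  have hzy : ∀ y : Ball d (f n), ∑ i, |(z.1 + y.1) i| ≤ ((f n + P.radius : ℕ) : ℤ) := fun y => by
    rw [add_comm (f n)]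
    exact sum_abs_add_le z.2 y.2
  refine Prod.ext ?_ ?_
  · exact (hx' ⟨z.1, z.2.trans (by push_cast; omega)⟩).symm
  · refine congrArg₂ (A n) (funext fun y => ?_) (funext fun y => ?_)
    · simp only [view, gridMove]
      rw [← torusMove_add, hext ⟨z.1 + y.1, hzy y⟩, add_assoc]
    · simp only [view, gridMove]
      rw [← torusMove_add, hx' ⟨z.1 + y.1, hzy y⟩, add_assoc]

/-- A single size `n = s ^ d` suffices, and the cubic torus of side `s` is admissible for every `K ≥
1`. The logarithmic complexity is needed only to find `s` much larger than the radius of the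
algorithm. -/
theorem LCL.InLOCALLogStar.inULOCALLogStar (hd : 1 ≤ d) {P : LCL d I O} {K : ℝ} (hK : 1 ≤ K)
    {a : ℕ} (ha : 1 ≤ a) (h : P.InLOCALLogStar K a) : P.InULOCALLogStar := by
  obtain ⟨f, hf, A, hA⟩ := h
  obtain ⟨c, hc, hfc⟩ := hf.exists_nonneg
  have hpow : Tendsto (fun s : ℕ => s ^ d) atTop atTop := tendsto_pow_atTop (by omega)
  obtain ⟨s, hAs, hfs, hside, hs⟩ := ((hpow.eventually hA).and ((hpow.eventually hfc.bound).and
    ((hpow.eventually (eventually_logStar_add_le hd (4 * c) (4 * P.radius + 2)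
      (by positivity))).and (eventually_ge_atTop 1)))).exists
  let n := s ^ d
  let W := f n + P.radius
  have hroot : ((n : ℕ) : ℝ) ^ (1 / (d : ℝ)) = s := by
    simp only [n]
    rw [Nat.cast_pow, one_div, Real.pow_rpow_inv_natCast (by positivity) (by omega)]
  -- This gives `(2 * (2 * W) + 1) ^ d < n`, so that the distance-`2 * W` colouring uses fewer than
  -- `n` colours, and also lets the ball of radius `W` embed in the torus.
  have hW : 4 * W + 2 ≤ s := by
    change _ ≤ ((n : ℕ) : ℝ) ^ (1 / (d : ℝ)) at hside
    rw [hroot] at hside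
    simp only [Real.norm_natCast] at hfs
    have : ((4 * W + 2 : ℕ) : ℝ) ≤ s := by
      simp only [W, n]
      push_cast at hfs hside ⊢
      linarith
    exact_mod_cast this
  have hprod : ∏ _i : Fin d, s = n := by simp [n]
  have htorus : IsTorusOfSize K (fun _ : Fin d => s) n := by
    refine ⟨fun _ => hs, hprod, fun _ => ?_⟩
    rw [hroot]
    have : (0 : ℝ) ≤ s := by positivity
    exact ⟨by nlinarith, by nlinarith⟩
  obtain ⟨col, hmeas, hshift, hle, hne, C, N, htail⟩ := exists_distance_coloring d (2 * W)
  have hlt : ∀ ω v, col ω v < n := by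
    intro ω v
    have h1 : Nat.card (Nbr d (2 * W)) ≤ Nat.card (Ball d (2 * W)) :=
      Nat.card_le_card_of_injective (fun z : Nbr d (2 * W) => (⟨z.1, z.2.2⟩ : Ball d (2 * W)))
        fun _ _ h => Subtype.ext (congrArg (fun z : Ball d (2 * W) => z.1) h)
    calc col ω v ≤ Nat.card (Ball d (2 * W)) := (hle ω v).trans h1
      _ ≤ (2 * (2 * W) + 1) ^ d := card_ball_le _ _
      _ < s ^ d := Nat.pow_lt_pow_left (by omega) (by omega)
  have hdecay := hasTowerDecay_view htail (f n)
  refine inULOCALLogStar_of_factor P (fun ω v => view gridMove (col ω) v (f n))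
    ⟨fun t => ?_, fun g ω => ?_, ae_factorRadius_lt_top hdecay⟩ hdecay (f n)
    (fun t x => A n (fun z => t z + 1) x) fun x => ?_
  · have : {ω | view gridMove (col ω) 0 (f n) = t} =
        ⋂ z : Ball d (f n), (fun ω => col ω (gridMove 0 z.1)) ⁻¹' {t z} := by
      ext ω
      simp only [Set.mem_ofPred_eq, Set.mem_iInter, Set.mem_preimage, Set.mem_singleton_iff]
      exact funext_iff
    rw [this]
    exact MeasurableSet.iInter fun z => hmeas _ (measurableSet_singleton _)
  · funext v z
    simp only [view, gridMove, hshift, add_assoc]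
  · filter_upwards [hne] with ω hω
    exact isColoring_of_distance_coloring ha (fun _ => by omega) hprod (hAs _ htorus) (hlt ω) hω x

end LocalToUniform

end GridLCL

/-- For every dimension `d ≥ 1`, every LCL `P` on `ℤ^d` and every choice of the constants `K`, `a`
in the `LOCAL` model, `P ∈ ULOCAL(O(log* 1/ε))` if and only if `P ∈ LOCAL(O(log* n))`; and if `P`
has no inputs (a single input label), these problems are exactly those with a finitary factor
of iid solution with tower-function tail decay. -/
theorem corollary3p3 {d : ℕ} (hd : 1 ≤ d) {I O : Type*} [Finite I] [Nonempty I] [Finite O]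
    (P : GridLCL.LCL d I O) (K : ℝ) (hK : 1 ≤ K) (a : ℕ) (ha : 1 ≤ a) :
    (P.InULOCALLogStar ↔ P.InLOCALLogStar K a) ∧
      (Subsingleton I → (P.HasTowerFFIID ↔ P.InLOCALLogStar K a)) := by
  have h : P.InULOCALLogStar ↔ P.InLOCALLogStar K a :=
    ⟨fun h => h.inLOCALLogStar hd hK a, fun h => h.inULOCALLogStar hd hK ha⟩
  refine ⟨h, fun _ => ?_⟩
  rw [← h]
  exact ⟨fun h' => h'.inULOCALLogStar, fun h' => h'.hasTowerFFIID⟩
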